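/- **Theorem 4.2.** Let $M\ge 1$ and let $\Gamma$ be a known positive definite $M\times M$ intraclass covariance matrix (all diagonal entries equal to $v$, all off-diagonal entries equal to $c$). Consider the one-sided testing problems $H_i:\mu_i=0$ versus $K_i^*:\mu_i>0$, $i=1,\dots,M$. *Tests and admissibility.* A test is a measurable function with values in $[0,1]$ on the sample space (its value is the probability of rejection). A test $\phi$ of $H$ versus $K$ is admissible if there is no test $\psi$ with $E_\theta\psi\le E_\theta\phi$ for all $\theta\in H$ and $E_\theta\psi\ge E_\theta\phi$ for all $\theta\in K$, with strict inequality for at least one $\theta\in H\cup K$. A multiple testing procedure is admissible if, for every $i$, its induced test $\phi_i$ (equal to $1$ if $H_i$ is rejected and $0$ otherwise) is an admissible test of $H_i$ versus $K_i^*$. *LRSD.* Let $C_1>C_2>\dots>C_M$ be real constants and let $X\sim N(\mu,\Gamma)$ be observed at $x\in\mathbb R^M$. Start with $S_1=\{1,\dots,M\}$. At stage $m=1,\dots,M$ carry out the likelihood ratio test of the global hypothesis $\mu_{S_m}=0$ versus $\mu_{S_m}\ge 0$ (coordinatewise), $\mu_{S_m}\ne 0$, based on the subvector $x_{S_m}$: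 reject if $2\log\Lambda\ge C_m$, where $\Lambda$ is the supremum of the likelihood over $\mu_{S_m}\ge 0$ divided by the likelihood at $\mu_{S_m}=0$. If the global hypothesis is not rejected, stop and accept all remaining $H_i$, $i\in S_m$. If it is rejected, reject $H_{j_m}$, where $x_{j_m}=\max_{j\in S_m}x_j$ (in a tie, the smallest such index), put $S_{m+1}=S_m\setminus\{j_m\}$ and go to stage $m+1$ (if $m=M$, stop). Then: 1. LRSD is admissible, both when the parameter space of $\mu$ is $[0,\infty)^M$ and when it is $\mathbb R^M$. 2. For every $i$, if $H_i$ is rejected by LRSD at $x^*$, then it is rejected at $x^*+\gamma g$ for every $\gamma>0$, where $g$ is the $i$-th column of $\Gamma$. 3. (Unknown $\sigma^2$, with replications.) Let $n\ge 2$ and let $X_1,\dots,X_n$ be a random sample from $N(\mu,\sigma^2\Gamma)$ with $\mu$ and $\sigma^2>0$ unknown. Consider the procedure defined as above, except that the coordinate removed at stage $m$ is the largest coordinate $\bar X_j$, $j\in S_m$, of the sample mean, and that the global test at stage $m$ is the likelihood ratio test based on the whole sample of $\mu_{S_m}=0$ versus $\mu_{S_m}\ge 0$, $\mu_{S_m}\neq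 0$, with $\sigma^2>0$ and the means $\mu_j$, $j\notin S_m$, unrestricted. This procedure is also admissible, for either of the parameter spaces $[0,\infty)^M\times(0,\infty)$ and $\mathbb R^M\times(0,\infty)$ of $(\mu,\sigma^2)$. -/

import Mathlib

open MeasureTheory ProbabilityTheory
open scoped ENNReal Matrix

noncomputable section

/-! ### Tests and admissibility -/

/-- A (possibly randomized) test on the sample space `𝓧`: a measurable function with values in
`[0, 1]`; `φ x` is the probability of rejecting the null hypothesis when `x` is observed. -/
structure IsTest {𝓧 : Type*} [MeasurableSpace 𝓧] (φ : 𝓧 → ℝ) : Prop where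
  measurable : Measurable φ
  nonneg : ∀ x, 0 ≤ φ x
  le_one : ∀ x, φ x ≤ 1

/-- For the model `θ ↦ P θ`, the test `ψ` is better than `φ` for testing `θ ∈ H` against `θ ∈ K`:
its probability of a type I error is nowhere larger on `H`, its power is nowhere smaller on `K`,
and one of these inequalities is strict somewhere. -/
def IsBetterTest {𝓧 Θ : Type*} [MeasurableSpace 𝓧] (P : Θ → Measure 𝓧) (H K : Set Θ)
    (ψ φ : 𝓧 → ℝ) : Prop :=
  (∀ θ ∈ H, ∫ x, ψ x ∂(P θ) ≤ ∫ x, φ x ∂(P θ)) ∧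
  (∀ θ ∈ K, ∫ x, φ x ∂(P θ) ≤ ∫ x, ψ x ∂(P θ)) ∧
  ((∃ θ ∈ H, ∫ x, ψ x ∂(P θ) < ∫ x, φ x ∂(P θ)) ∨
    (∃ θ ∈ K, ∫ x, φ x ∂(P θ) < ∫ x, ψ x ∂(P θ)))

/-- `φ` is an admissible test of `θ ∈ H` against `θ ∈ K`: it is a test and no test is better. -/
def IsAdmissibleTest {𝓧 Θ : Type*} [MeasurableSpace 𝓧] (P : Θ → Measure 𝓧) (H K : Set Θ)
    (φ : 𝓧 → ℝ) : Prop :=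
  IsTest φ ∧ ¬ ∃ ψ : 𝓧 → ℝ, IsTest ψ ∧ IsBetterTest P H K ψ φ

/-! ### Likelihood ratio tests -/

/-- The likelihood ratio test of `θ ∈ H` against `θ ∈ K` with likelihood `L θ x` rejects at `x`,
with critical value `c`, when `2 log Λ ≥ c`, where `Λ` is the supremum of the likelihood over
`H ∪ K` divided by its supremum over `H`.  This is written as `exp (c / 2) * sup_H ≤ sup_{H ∪ K}`
in `[0, ∞]`. -/
def LRTRejects {𝓧 Θ : Type*} (L : Θ → 𝓧 → ℝ) (H K : Set Θ) (c : ℝ) (x : 𝓧) : Prop :=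
  ENNReal.ofReal (Real.exp (c / 2)) * (⨆ θ ∈ H, ENNReal.ofReal (L θ x)) ≤
    ⨆ θ ∈ H ∪ K, ENNReal.ofReal (L θ x)

/-- The density at `x` of the normal distribution with mean `μ` and covariance matrix `Γ`. -/
def normalDensity {ι : Type*} [Fintype ι] [DecidableEq ι] (Γ : Matrix ι ι ℝ) (μ x : ι → ℝ) : ℝ :=
  (Real.sqrt ((2 * Real.pi) ^ Fintype.card ι * Γ.det))⁻¹ *
    Real.exp (-(1 / 2) * ((x - μ) ⬝ᵥ (Γ⁻¹ *ᵥ (x - μ))))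

/-! ### The intraclass model -/

/-- The intraclass covariance matrix: all variances equal `v`, all covariances equal `c`. -/
def intraclass (M : ℕ) (v c : ℝ) : Matrix (Fin M) (Fin M) ℝ :=
  Matrix.of fun i j => if i = j then v else c

/-! ### Step-down procedures that remove the largest coordinate -/

theorem argmax_nonempty {M : ℕ} (x : Fin M → ℝ) (S : Finset (Fin M)) (hS : S.Nonempty) :
    (S.filter fun j => ∀ k ∈ S, x k ≤ x j).Nonempty := by
  obtain ⟨j, hj, h⟩ := S.exists_max_image x hS
  exact ⟨j, Finset.mem_filter.2 ⟨hj, h⟩⟩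

/-- The index of the largest coordinate of `x` among those in `S` (ties: the smallest index). -/
def leading {M : ℕ} (x : Fin M → ℝ) (S : Finset (Fin M)) (hS : S.Nonempty) : Fin M :=
  (S.filter fun j => ∀ k ∈ S, x k ≤ x j).min' (argmax_nonempty x S hS)

open scoped Classical in
/-- The set of indices rejected from stage `m` on, when `S` is the set of indices still under
consideration and at most `r` further stages are carried out.  `G m S` says that the global
hypothesis `μ_j = 0` for all `j ∈ S` is rejected at stage `m`.  If it is not, the procedure stops
and accepts all remaining hypotheses; if it is, the hypothesis belonging to the largest remaining
coordinate of `x` is rejected and the procedure continues to stage `m + 1` without it. -/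
def stepDownFrom {M : ℕ} (G : ℕ → Finset (Fin M) → Prop) (x : Fin M → ℝ) :
    (r m : ℕ) → (S : Finset (Fin M)) → Finset (Fin M)
  | 0, _, _ => ∅
  | r + 1, m, S =>
    if h : S.Nonempty ∧ G m S then
      insert (leading x S h.1) (stepDownFrom G x r (m + 1) (S.erase (leading x S h.1)))
    else ∅

/-- The set of indices rejected by the whole procedure: stages `1, …, M`, starting with all
indices. -/
def stepDown {M : ℕ} (G : ℕ → Finset (Fin M) → Prop) (x : Fin M → ℝ) : Finset (Fin M) :=
  stepDownFrom G x M 1 Finset.univ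

/-! ### LRSD, covariance matrix known -/

/-- The one-sided global test for the coordinates in `S`, based on the subvector `x_S`, which is
normal with covariance matrix the corresponding submatrix of `Γ`: the likelihood ratio test of
`μ_S = 0` against `μ_S ≥ 0, μ_S ≠ 0`. -/
def globalRejects {M : ℕ} (Γ : Matrix (Fin M) (Fin M) ℝ) (c : ℝ) (x : Fin M → ℝ)
    (S : Finset (Fin M)) : Prop :=
  LRTRejects
    (fun (μ x : S → ℝ) => normalDensity (Γ.submatrix (fun j : S => (j : Fin M)) fun j => j) μ x)
    {0} {μ | (∀ j, 0 ≤ μ j) ∧ μ ≠ 0} c (fun j => x j)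

/-- The set of indices `i` such that `H_i` is rejected by LRSD, for one-sided alternatives, at the
sample point `x`; `C m` is the critical value of stage `m = 1, …, M`. -/
def lrsd {M : ℕ} (Γ : Matrix (Fin M) (Fin M) ℝ) (C : ℕ → ℝ) (x : Fin M → ℝ) :
    Finset (Fin M) :=
  stepDown (fun m S => globalRejects Γ (C m) x S) x

/-- The individual (nonrandomized) test of `H_i` induced by LRSD. -/
def lrsdTest {M : ℕ} (Γ : Matrix (Fin M) (Fin M) ℝ) (C : ℕ → ℝ) (i : Fin M)
    (x : EuclideanSpace ℝ (Fin M)) : ℝ :=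
  if i ∈ lrsd Γ C x then 1 else 0

/-! ### LRSD, unknown scale factor `σ²`, sample of size `n` -/

/-- The likelihood of `(μ, σ²)` for a sample `X_1, …, X_n` from the normal distribution with mean
`μ` and covariance matrix `σ² Γ`. -/
def sampleLikelihood {M n : ℕ} (Γ : Matrix (Fin M) (Fin M) ℝ) (θ : (Fin M → ℝ) × ℝ)
    (X : Fin n → EuclideanSpace ℝ (Fin M)) : ℝ :=
  ∏ α, normalDensity (θ.2 • Γ) θ.1 (X α)

/-- The one-sided global test for the coordinates in `S`, `σ²` unknown, based on the whole sample:
the likelihood ratio test of `μ_S = 0` against `μ_S ≥ 0, μ_S ≠ 0` (the other means are free). -/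
def globalRejectsSample {M n : ℕ} (Γ : Matrix (Fin M) (Fin M) ℝ) (c : ℝ)
    (X : Fin n → EuclideanSpace ℝ (Fin M)) (S : Finset (Fin M)) : Prop :=
  LRTRejects (sampleLikelihood Γ)
    {θ : (Fin M → ℝ) × ℝ | 0 < θ.2 ∧ ∀ j ∈ S, θ.1 j = 0}
    {θ : (Fin M → ℝ) × ℝ | 0 < θ.2 ∧ (∀ j ∈ S, 0 ≤ θ.1 j) ∧ ∃ j ∈ S, θ.1 j ≠ 0} c X

/-- The coordinates of the sample mean. -/
def sampleMean {M n : ℕ} (X : Fin n → EuclideanSpace ℝ (Fin M)) : Fin M → ℝ :=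
  fun j => (∑ α, X α j) / n

/-- The set of indices `i` such that `H_i` is rejected by LRSD, `σ²` unknown: at each stage the
index of the largest remaining coordinate of the sample mean is the one removed. -/
def lrsdSample {M n : ℕ} (Γ : Matrix (Fin M) (Fin M) ℝ) (C : ℕ → ℝ)
    (X : Fin n → EuclideanSpace ℝ (Fin M)) : Finset (Fin M) :=
  stepDown (fun m S => globalRejectsSample Γ (C m) X S) (sampleMean X)

/-- The individual (nonrandomized) test of `H_i` induced by LRSD, `σ²` unknown. -/
def lrsdSampleTest {M n : ℕ} (Γ : Matrix (Fin M) (Fin M) ℝ) (C : ℕ → ℝ) (i : Fin M)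
    (X : Fin n → EuclideanSpace ℝ (Fin M)) : ℝ :=
  if i ∈ lrsdSample Γ C X then 1 else 0

end

/-! The model is an exponential family in `W = Γ⁻¹ x` (or `Γ⁻¹ X̄`), and the natural parameter
belonging to `U = W i` is a positive multiple of `μ i`. The remaining natural statistics are
collected in `V`, so `H_i` says that one natural parameter vanishes and the alternative says that it
is positive.

Admissibility then follows from a general fact, `isAdmissibleTest_of_monotone_section`: it suffices
that for each fixed value of `V` the test rejects on an up-set of values of `U`. Let `ψ` be at least
as good as such a test `φ`. Letting the tested parameter decrease to zero turns the power inequality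
into a size inequality, so `ψ` and `φ` have equal size at a full positive orthant of nuisance
parameters. Completeness (`lintegral_comp_eq_of_forall_integral_eq`) makes them agree conditionally
on `V`, and a conditional Neyman–Pearson argument (`lintegral_le_of_monotone_section`) shows that
`ψ` is nowhere more powerful. Hence no inequality can be strict. Only nonnegative means are needed
for this completeness, which is why both parameter spaces are covered.

It remains to see the up-set property. Raising `U` with `V` fixed moves `x` along the `i`-th column
of `Γ`. Up to a factor independent of the mean, each likelihood is multiplied by `exp (γ * μ i)`
(with an extra `n / σ²` in the exponent for a sample). This is `1` under a global null involving `i`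
and at least `1` under the alternative, so global rejection persists (`globalRejects_add_col`,
`mem_lrsdSufficient_add_single`). By the intraclass structure the other coordinates all shift
equally and the `i`-th by at least as much, so the order of removal is unchanged until `i` itself is
removed (`mem_stepDownFrom_mono`). -/

/-! ### Densities of Gaussian measures -/

theorem pi_withDensity_ofReal {ι : Type*} [Fintype ι] {α : ι → Type*}
    [∀ i, MeasurableSpace (α i)] (μ : ∀ i, Measure (α i)) [∀ i, SigmaFinite (μ i)]
    (f : ∀ i, α i → ℝ) (hf0 : ∀ i x, 0 ≤ f i x)
    (hfi : ∀ i, Integrable (f i) (μ i)) :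
    Measure.pi (fun i => (μ i).withDensity fun x => ENNReal.ofReal (f i x)) =
      (Measure.pi μ).withDensity fun x => ENNReal.ofReal (∏ i, f i (x i)) := by
  have hfin : ∀ i, IsFiniteMeasure ((μ i).withDensity fun x => ENNReal.ofReal (f i x)) := fun i =>
    isFiniteMeasure_withDensity_ofReal (hfi i).2
  refine (Measure.pi_eq fun s hs => ?_)
  rw [withDensity_apply _ (MeasurableSet.univ_pi hs),
    ← lintegral_indicator (MeasurableSet.univ_pi hs)]
  -- Masses of box factors become real integrals, so that the product formula for Bochner integrals
  -- applies.
  have h1 : ∀ i, (μ i).withDensity (fun x => ENNReal.ofReal (f i x)) (s i) =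
      ENNReal.ofReal (∫ x, (s i).indicator (f i) x ∂(μ i)) := by
    intro i
    rw [withDensity_apply _ (hs i), integral_indicator (hs i),
      ofReal_integral_eq_lintegral_ofReal (hfi i).integrableOn (ae_of_all _ (hf0 i))]
  simp_rw [h1]
  rw [← ENNReal.ofReal_prod_of_nonneg
    fun i _ => integral_nonneg (Set.indicator_nonneg fun x _ => hf0 i x),
    ← integral_fintype_prod_eq_prod (fun i => (s i).indicator (f i)),
    ofReal_integral_eq_lintegral_ofReal
      (Integrable.fintype_prod_dep fun i => (hfi i).indicator (hs i))
      (ae_of_all _ fun x => Finset.prod_nonneg fun i _ =>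
        Set.indicator_nonneg (fun x _ => hf0 i x) _)]
  refine lintegral_congr fun x => ?_
  by_cases hx : x ∈ Set.univ.pi s
  · rw [Set.indicator_of_mem hx]
    congr 1
    exact Finset.prod_congr rfl fun i _ => (Set.indicator_of_mem (hx i trivial) _).symm
  · rw [Set.indicator_of_notMem hx]
    obtain ⟨i, hi⟩ : ∃ i, x i ∉ s i := by simpa [Set.mem_pi] using hx
    rw [Finset.prod_eq_zero (Finset.mem_univ i) (Set.indicator_of_notMem hi _)]
    simp

theorem map_withDensity_comp {α β : Type*} [MeasurableSpace α] [MeasurableSpace β]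
    (ν : Measure α) {f : α → β} (hf : Measurable f) {g : β → ℝ≥0∞} (hg : Measurable g) :
    (ν.withDensity fun x => g (f x)).map f = (ν.map f).withDensity g := by
  ext s hs
  rw [Measure.map_apply hf hs, withDensity_apply _ (hf hs), withDensity_apply _ hs,
    setLIntegral_map hs hg hf]

theorem stdGaussian_eq_withDensity (ι : Type*) [Fintype ι] :
    stdGaussian (EuclideanSpace ℝ ι) = volume.withDensity fun x =>
      ENNReal.ofReal ((Real.sqrt (2 * Real.pi))⁻¹ ^ Fintype.card ι *
        Real.exp (-(1 / 2) * (x.ofLp ⬝ᵥ x.ofLp))) := by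
  have h1 : gaussianReal 0 1 = volume.withDensity fun x =>
      ENNReal.ofReal (gaussianPDFReal 0 1 x) := by
    rw [gaussianReal_of_var_ne_zero _ one_ne_zero]; rfl
  rw [← map_pi_eq_stdGaussian, h1, pi_withDensity_ofReal (fun _ => volume)
    (fun _ => gaussianPDFReal 0 1)
    (fun _ => gaussianPDFReal_nonneg 0 1) (fun _ => integrable_gaussianPDFReal 0 1),
    ← (PiLp.volume_preserving_toLp ι).map_eq, ← volume_pi, ← map_withDensity_comp]
  · congr 2
    ext x
    congr 1
    simp only [gaussianPDFReal, Finset.prod_mul_distrib, Finset.prod_const, ← Real.exp_sum,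
      dotProduct, Finset.mul_sum]
    simp only [Finset.card_univ]
    congr 1
    · simp
    · congr 1
      refine Finset.sum_congr rfl fun i _ => ?_
      simp; ring
  · fun_prop
  · fun_prop

open scoped MatrixOrder in
-- Change of variables under `x ↦ μ + √S x`, which carries the standard Gaussian to this one. The
-- normalizing constant is left implicit: admissibility uses only that it is positive.
theorem exists_multivariateGaussian_eq_withDensity {ι : Type*} [Fintype ι] [DecidableEq ι]
    {S : Matrix ι ι ℝ} (hS : S.PosDef) :
    ∃ k : ℝ, 0 < k ∧ ∀ μ : EuclideanSpace ℝ ι, multivariateGaussian μ S =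
      volume.withDensity fun x => ENNReal.ofReal (k *
        Real.exp (-(1 / 2) * ((x.ofLp - μ.ofLp) ⬝ᵥ (S⁻¹ *ᵥ (x.ofLp - μ.ofLp))))) := by
  set R := CFC.sqrt S with hR
  have hRR : R * R = S := by
    exact CFC.sqrt_mul_sqrt_self _ hS.posSemidef.nonneg
  have hRt : Rᵀ = R := by
    have : R.PosSemidef := by
      exact Matrix.nonneg_iff_posSemidef.1 (CFC.sqrt_nonneg S)
    simpa [Matrix.IsHermitian] using this.1
  have hdet : IsUnit R.det := by
    have h := hS.det_pos
    rw [← hRR, Matrix.det_mul] at h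
    exact isUnit_iff_ne_zero.2 fun h0 => by simp [h0] at h
  set T := Matrix.toEuclideanCLM (𝕜 := ℝ) R with hT
  have hTdet : LinearMap.det (T : EuclideanSpace ℝ ι →ₗ[ℝ] EuclideanSpace ℝ ι) ≠ 0 := by
    have : LinearMap.det (T : EuclideanSpace ℝ ι →ₗ[ℝ] EuclideanSpace ℝ ι) = R.det := by
      rw [hT, Matrix.coe_toEuclideanCLM_eq_toEuclideanLin]
      rw [← LinearMap.det_toLin (PiLp.basisFun 2 ℝ ι) R]
      exact congrArg (fun g => LinearMap.det (g R)) (Matrix.toLpLin_eq_toLin 2 2)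
    rw [this]; exact hdet.ne_zero
  set d := |(LinearMap.det (T : EuclideanSpace ℝ ι →ₗ[ℝ] EuclideanSpace ℝ ι))⁻¹| with hd
  have hd0 : 0 < d := abs_pos.2 (inv_ne_zero hTdet)
  set k0 := (Real.sqrt (2 * Real.pi))⁻¹ ^ Fintype.card ι with hk0
  have hk0' : 0 < k0 := by positivity
  refine ⟨d * k0, by positivity, fun μ => ?_⟩
  set f : EuclideanSpace ℝ ι → EuclideanSpace ℝ ι := fun x => μ + T x with hf
  have hfm : Measurable f := by fun_prop
  have hmap : (volume : Measure (EuclideanSpace ℝ ι)).map f = ENNReal.ofReal d • volume := by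
    have : f = (fun x => μ + x) ∘ T := rfl
    rw [this, ← Measure.map_map (by fun_prop) (by fun_prop)]
    have h2 := Measure.map_linearMap_addHaar_eq_smul_addHaar
      (volume : Measure (EuclideanSpace ℝ ι)) hTdet
    have h3 : (volume : Measure (EuclideanSpace ℝ ι)).map T = ENNReal.ofReal d • volume := h2
    rw [h3, Measure.map_smul, map_add_left_eq_self]
  set G : EuclideanSpace ℝ ι → ℝ≥0∞ := fun x => ENNReal.ofReal (k0 *
        Real.exp (-(1 / 2) * ((x.ofLp - μ.ofLp) ⬝ᵥ (S⁻¹ *ᵥ (x.ofLp - μ.ofLp))))) with hG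
  have hGm : Measurable G := by
    refine Measurable.ennreal_ofReal (Continuous.measurable ?_)
    fun_prop
  have hGf : ∀ x, G (f x) = ENNReal.ofReal (k0 * Real.exp (-(1 / 2) * (x.ofLp ⬝ᵥ x.ofLp))) := by
    intro x
    have hx : (f x).ofLp - μ.ofLp = R *ᵥ x.ofLp := by
      simp [hf, hT, Matrix.ofLp_toEuclideanCLM]
    have hq : (R *ᵥ x.ofLp) ⬝ᵥ (S⁻¹ *ᵥ (R *ᵥ x.ofLp)) = x.ofLp ⬝ᵥ x.ofLp := by
      have : R * (S⁻¹ * R) = 1 := by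
        rw [← hRR, Matrix.mul_inv_rev, Matrix.mul_assoc, Matrix.nonsing_inv_mul _ hdet,
          Matrix.mul_one, Matrix.mul_nonsing_inv _ hdet]
      rw [dotProduct_comm, Matrix.dotProduct_mulVec, ← Matrix.mulVec_transpose, hRt,
        Matrix.mulVec_mulVec, Matrix.mulVec_mulVec, Matrix.mul_assoc, this, Matrix.one_mulVec]
    rw [hG]
    simp only [hx, hq]
  rw [multivariateGaussian, stdGaussian_eq_withDensity]
  have := map_withDensity_comp (volume : Measure (EuclideanSpace ℝ ι)) hfm hGm
  simp_rw [hGf] at this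
  rw [← hT, ← hf, this, hmap, withDensity_smul_measure,
    ← withDensity_smul _ hGm]
  congr 1
  ext x
  simp only [hG, Pi.smul_apply, smul_eq_mul]
  rw [← ENNReal.ofReal_mul hd0.le]
  congr 1; ring

/-! ### Completeness and one-sided tests in exponential families -/

section

open Filter Topology

/-- Both complex moment generating functions are analytic on the vertical strip over `(-ε, ε)` and
agree on its real points, so the identity theorem applies. The value at `I` is the one that yields
characteristic functions. -/
theorem complexMGF_I_eq_of_mgf_eqOn {Ω Ω' : Type*} {m : MeasurableSpace Ω}
    {m' : MeasurableSpace Ω'} {μ : Measure Ω} {μ' : Measure Ω'} {X : Ω → ℝ} {Y : Ω' → ℝ} {ε : ℝ}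
    (hε : 0 < ε)
    (hX : ∀ s, |s| < ε → Integrable (fun ω => Real.exp (s * X ω)) μ)
    (hY : ∀ s, |s| < ε → Integrable (fun ω => Real.exp (s * Y ω)) μ')
    (h : ∀ s, |s| < ε → mgf X μ s = mgf Y μ' s) :
    complexMGF X μ Complex.I = complexMGF Y μ' Complex.I := by
  have hball : IsOpen {s : ℝ | |s| < ε} := isOpen_lt continuous_abs continuous_const
  have hXs : {s : ℝ | |s| < ε} ⊆ interior (integrableExpSet X μ) :=
    interior_maximal (fun s hs => hX s hs) hball
  have hYs : {s : ℝ | |s| < ε} ⊆ interior (integrableExpSet Y μ') :=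
    interior_maximal (fun s hs => hY s hs) hball
  have hcv : Convex ℝ {s : ℝ | |s| < ε} := by
    have : {s : ℝ | |s| < ε} = Metric.ball 0 ε := by ext; simp
    rw [this]; exact convex_ball _ _
  have key : Set.EqOn (complexMGF X μ) (complexMGF Y μ') {z | z.re ∈ {s : ℝ | |s| < ε}} := by
    refine AnalyticOnNhd.eqOn_of_preconnected_of_frequently_eq
      (analyticOnNhd_complexMGF.mono fun z hz => hXs hz)
      (analyticOnNhd_complexMGF.mono fun z hz => hYs hz)
      (hcv.linear_preimage Complex.reLm).isPreconnected (z₀ := ((0 : ℝ) : ℂ)) (by simp [hε]) ?_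
    have h_real : ∃ᶠ (x : ℝ) in 𝓝[≠] 0, complexMGF X μ x = complexMGF Y μ' x := by
      refine Eventually.frequently ?_
      filter_upwards [mem_nhdsWithin_of_mem_nhds (hball.mem_nhds (show |(0 : ℝ)| < ε by simpa))]
        with x hx
      rw [complexMGF_ofReal, complexMGF_ofReal, h x hx]
    rw [frequently_iff_seq_forall] at h_real ⊢
    obtain ⟨xs, hx_tendsto, hx_eq⟩ := h_real
    refine ⟨fun n ↦ xs n, ?_, fun n ↦ ?_⟩
    · rw [tendsto_nhdsWithin_iff] at hx_tendsto ⊢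
      constructor
      · rw [tendsto_ofReal_iff]
        exact hx_tendsto.1
      · simpa using hx_tendsto.2
    · simp [hx_eq]
  exact key (by simp [hε])

theorem measure_ext_of_mgf_dual {E : Type*} [NormedAddCommGroup E] [NormedSpace ℝ E]
    [MeasurableSpace E] [BorelSpace E] [SecondCountableTopology E] [CompleteSpace E]
    {μ μ' : Measure E} [IsFiniteMeasure μ] [IsFiniteMeasure μ']
    (h : ∀ L : StrongDual ℝ E, ∃ ε > 0, ∀ s, |s| < ε →
      Integrable (fun x => Real.exp (s * L x)) μ ∧ Integrable (fun x => Real.exp (s * L x)) μ' ∧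
      ∫ x, Real.exp (s * L x) ∂μ = ∫ x, Real.exp (s * L x) ∂μ') : μ = μ' := by
  refine Measure.ext_of_charFunDual ?_
  ext L
  obtain ⟨ε, hε, hL⟩ := h L
  have := complexMGF_I_eq_of_mgf_eqOn (X := L) (Y := L) hε (fun s hs => (hL s hs).1)
    (fun s hs => (hL s hs).2.1) (fun s hs => (hL s hs).2.2)
  simpa [complexMGF, charFunDual_apply, mul_comm] using this

/-- Completeness of an exponential family whose natural parameter ranges over the positive
orthant: the tests `ψ` and `φ` have the same conditional expectation given `V`. -/
theorem lintegral_comp_eq_of_forall_integral_eq {𝓧 ι : Type*} [MeasurableSpace 𝓧] [Fintype ι]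
    {ν : Measure 𝓧} {V : 𝓧 → ι → ℝ} (hV : Measurable V)
    (hint : ∀ β : ι → ℝ, (∀ j, 0 < β j) → Integrable (fun x => Real.exp (β ⬝ᵥ V x)) ν)
    {ψ φ : 𝓧 → ℝ} (hψ : IsTest ψ) (hφ : IsTest φ)
    (heq : ∀ β : ι → ℝ, (∀ j, 0 < β j) →
      ∫ x, ψ x * Real.exp (β ⬝ᵥ V x) ∂ν = ∫ x, φ x * Real.exp (β ⬝ᵥ V x) ∂ν)
    {h : (ι → ℝ) → ℝ≥0∞} (hh : Measurable h) :
    ∫⁻ x, ENNReal.ofReal (ψ x) * h (V x) ∂ν = ∫⁻ x, ENNReal.ofReal (φ x) * h (V x) ∂ν := by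
  classical
  -- Tilting by the interior point `1` of the orthant makes the measures finite and places a
  -- neighbourhood of the origin inside the domain of their moment generating functions.
  set w : 𝓧 → ℝ := fun x => Real.exp (1 ⬝ᵥ V x) with hw
  have hexpm : ∀ β : ι → ℝ, Measurable fun x => Real.exp (β ⬝ᵥ V x) := fun β => by
    have : Continuous fun v : ι → ℝ => Real.exp (β ⬝ᵥ v) := by fun_prop
    exact this.measurable.comp hV
  have htest : ∀ {χ : 𝓧 → ℝ}, IsTest χ → ∀ β : ι → ℝ, (∀ j, 0 < β j) →
      Integrable (fun x => χ x * Real.exp (β ⬝ᵥ V x)) ν := by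
    intro χ hχ β hβ
    refine (hint β hβ).mono' (hχ.measurable.mul (hexpm β)).aestronglyMeasurable
      (ae_of_all _ fun x => ?_)
    rw [Real.norm_eq_abs, abs_of_nonneg (mul_nonneg (hχ.nonneg x) (Real.exp_pos _).le)]
    exact mul_le_of_le_one_left (Real.exp_pos _).le (hχ.le_one x)
  let m : (𝓧 → ℝ) → Measure (ι → ℝ) := fun χ =>
    (ν.withDensity fun x => ENNReal.ofReal (χ x * w x)).map V
  have hfin : ∀ {χ : 𝓧 → ℝ}, IsTest χ → IsFiniteMeasure (m χ) := by
    intro χ hχ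
    have := isFiniteMeasure_withDensity_ofReal (htest hχ 1 fun _ => one_pos).2
    exact Measure.isFiniteMeasure_map _ V
  have hwm : ∀ {χ : 𝓧 → ℝ}, IsTest χ → Measurable fun x => χ x * w x :=
    fun hχ => hχ.measurable.mul (hexpm 1)
  have hm : m ψ = m φ := by
    have := hfin hψ
    have := hfin hφ
    refine measure_ext_of_mgf_dual fun L => ?_
    set l : ι → ℝ := fun j => L (Pi.single j 1) with hl
    have hL : ∀ v, L v = l ⬝ᵥ v := by
      intro v
      conv_lhs => rw [pi_eq_sum_univ' v]
      simp [dotProduct, hl, mul_comm]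
    -- Small enough that `1 + s • l` stays in the positive orthant when `|s| < ε`.
    set ε : ℝ := (1 + ∑ j, |l j|)⁻¹ with hε
    have hpos : 0 < 1 + ∑ j, |l j| := by positivity
    have hβ : ∀ s, |s| < ε → ∀ j, 0 < (1 + s • l) j := by
      intro s hs j
      have h1 : |l j| ≤ ∑ j, |l j| :=
        Finset.single_le_sum (f := fun j => |l j|) (fun _ _ => abs_nonneg _) (Finset.mem_univ j)
      have h2 : |s * l j| < 1 := by
        rw [abs_mul]
        calc |s| * |l j| ≤ |s| * (1 + ∑ j, |l j|) := by gcongr; linarith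
          _ < ε * (1 + ∑ j, |l j|) := by gcongr
          _ = 1 := inv_mul_cancel₀ hpos.ne'
      have := (abs_lt.1 h2).1
      simp only [Pi.add_apply, Pi.one_apply, Pi.smul_apply, smul_eq_mul]
      linarith
    have hrew : ∀ (χ : 𝓧 → ℝ) s x, χ x * w x * Real.exp (s * L (V x)) =
        χ x * Real.exp ((1 + s • l) ⬝ᵥ V x) := by
      intro χ s x
      rw [mul_assoc, hw, hL, ← Real.exp_add, add_dotProduct, smul_dotProduct, smul_eq_mul]
    have hem : ∀ s : ℝ, Measurable fun v : ι → ℝ => Real.exp (s * L v) := fun s =>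
      Continuous.measurable (by fun_prop)
    have hnn : ∀ {χ : 𝓧 → ℝ}, IsTest χ → ∀ x, 0 ≤ χ x * w x :=
      fun hχ x => mul_nonneg (hχ.nonneg x) (Real.exp_pos _).le
    have hI : ∀ {χ : 𝓧 → ℝ}, IsTest χ → ∀ s, |s| < ε →
        Integrable (fun v => Real.exp (s * L v)) (m χ) := by
      intro χ hχ s hs
      rw [integrable_map_measure (hem s).aestronglyMeasurable hV.aemeasurable,
        integrable_withDensity_iff_integrable_smul' (hwm hχ).ennreal_ofReal
          (ae_of_all _ fun x => ENNReal.ofReal_lt_top)]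
      refine (htest hχ _ (hβ s hs)).congr (ae_of_all _ fun x => ?_)
      simp only [ENNReal.toReal_ofReal (hnn hχ x), smul_eq_mul, Function.comp, hrew]
    have hE : ∀ {χ : 𝓧 → ℝ}, IsTest χ → ∀ s,
        ∫ v, Real.exp (s * L v) ∂(m χ) = ∫ x, χ x * Real.exp ((1 + s • l) ⬝ᵥ V x) ∂ν := by
      intro χ hχ s
      rw [integral_map hV.aemeasurable (hem s).aestronglyMeasurable,
        integral_withDensity_eq_integral_toReal_smul (hwm hχ).ennreal_ofReal
          (ae_of_all _ fun x => ENNReal.ofReal_lt_top)]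
      refine integral_congr_ae (ae_of_all _ fun x => ?_)
      simp only [ENNReal.toReal_ofReal (hnn hχ x), smul_eq_mul, hrew]
    refine ⟨ε, inv_pos.2 hpos, fun s hs => ⟨hI hψ s hs, hI hφ s hs, ?_⟩⟩
    rw [hE hψ, hE hφ, heq _ (hβ s hs)]
  -- The exponential undoes the tilt `w`.
  set g : (ι → ℝ) → ℝ≥0∞ := fun v => ENNReal.ofReal (Real.exp (-(1 ⬝ᵥ v))) * h v with hg
  have hgm : Measurable g := by
    refine Measurable.mul (Measurable.ennreal_ofReal (Continuous.measurable ?_)) hh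
    fun_prop
  have hlin : ∀ {χ : 𝓧 → ℝ}, IsTest χ →
      ∫⁻ v, g v ∂(m χ) = ∫⁻ x, ENNReal.ofReal (χ x) * h (V x) ∂ν := by
    intro χ hχ
    rw [lintegral_map hgm hV]
    refine (lintegral_withDensity_eq_lintegral_mul ν (hwm hχ).ennreal_ofReal
      (hgm.comp hV)).trans (lintegral_congr fun x => ?_)
    simp only [Pi.mul_apply, Function.comp, hg]
    rw [← mul_assoc, ← ENNReal.ofReal_mul (mul_nonneg (hχ.nonneg x) (Real.exp_pos _).le),
      mul_assoc, ← Real.exp_add]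
    simp
  rw [← hlin hψ, ← hlin hφ, hm]

/-- The weighted Neyman–Pearson inequality: a test that is monotone in `u` for each `v`, with
`E ψ = E φ` conditionally on `V` at `a = 0`, has the largest power at `a > 0`. -/
theorem lintegral_le_of_monotone_section {𝓧 E : Type*} [MeasurableSpace 𝓧] [MeasurableSpace E]
    {ν : Measure 𝓧} {U : 𝓧 → ℝ} {V : 𝓧 → E} (hU : Measurable U) (hV : Measurable V)
    {f : ℝ → E → Prop} (hf : ∀ r, MeasurableSet {v | f r v})
    (hmono : ∀ v r s, r ≤ s → f r v → f s v)
    {ψ φ : 𝓧 → ℝ} (hψ : IsTest ψ) (hφ : IsTest φ)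
    (hφ1 : ∀ x, f (U x) (V x) → φ x = 1) (hφ0 : ∀ x, ¬ f (U x) (V x) → φ x = 0)
    {w : E → ℝ≥0∞} (hw : Measurable w)
    (hfin : ∫⁻ x, w (V x) ∂ν ≠ ∞)
    (heq : ∀ h : E → ℝ≥0∞, Measurable h →
      ∫⁻ x, ENNReal.ofReal (ψ x) * h (V x) ∂ν = ∫⁻ x, ENNReal.ofReal (φ x) * h (V x) ∂ν)
    {a : ℝ} (ha : 0 < a) :
    ∫⁻ x, ENNReal.ofReal (ψ x) * (ENNReal.ofReal (Real.exp (a * U x)) * w (V x)) ∂ν ≤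
      ∫⁻ x, ENNReal.ofReal (φ x) * (ENNReal.ofReal (Real.exp (a * U x)) * w (V x)) ∂ν := by
  classical
  -- The value of `exp (a * u)` at the left end of the rejection section over `v`, and `∞` if the
  -- section is empty. Rational cut points keep it measurable.
  set τ : E → ℝ≥0∞ := fun v => ⨅ r : ℚ, if f r v then ENNReal.ofReal (Real.exp (a * r)) else ∞
    with hτ
  have hτm : Measurable τ :=
    Measurable.iInf fun r => Measurable.ite (hf r) measurable_const measurable_const
  have hτle : ∀ u v, f u v → τ v ≤ ENNReal.ofReal (Real.exp (a * u)) := by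
    intro u v huv
    have hc : Tendsto (fun r : ℝ => ENNReal.ofReal (Real.exp (a * r))) (𝓝[>] u)
        (𝓝 (ENNReal.ofReal (Real.exp (a * u)))) := by
      refine Tendsto.mono_left (Continuous.tendsto ?_ u) nhdsWithin_le_nhds
      exact ENNReal.continuous_ofReal.comp (by fun_prop)
    refine ge_of_tendsto hc ?_
    filter_upwards [self_mem_nhdsWithin] with r hr
    obtain ⟨q, hq1, hq2⟩ := exists_rat_btwn (show u < r from hr)
    refine (iInf_le _ q).trans ?_
    rw [if_pos (hmono v _ _ hq1.le huv)]
    gcongr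
  have hleτ : ∀ u v, ¬ f u v → ENNReal.ofReal (Real.exp (a * u)) ≤ τ v := by
    intro u v huv
    refine le_iInf fun q => ?_
    split_ifs with h
    · have : u ≤ q := by
        by_contra hlt
        exact huv (hmono v _ _ (not_le.1 hlt).le h)
      gcongr
    · exact le_top
  -- The Neyman–Pearson inequality `(φ - ψ) * (exp (a * U) - τ) ≥ 0`, rearranged to avoid
  -- subtraction in `[0, ∞]`.
  have hpt : ∀ x, ENNReal.ofReal (ψ x) * ENNReal.ofReal (Real.exp (a * U x)) +
      ENNReal.ofReal (φ x) * τ (V x) ≤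
      ENNReal.ofReal (φ x) * ENNReal.ofReal (Real.exp (a * U x)) +
        ENNReal.ofReal (ψ x) * τ (V x) := by
    intro x
    by_cases h : f (U x) (V x)
    · rw [hφ1 x h]
      have h1 := hτle _ _ h
      have h2 : ENNReal.ofReal (ψ x) + ENNReal.ofReal (1 - ψ x) = 1 := by
        rw [← ENNReal.ofReal_add (hψ.nonneg x) (sub_nonneg.2 (hψ.le_one x))]
        simp
      simp only [ENNReal.ofReal_one, one_mul]
      set e := ENNReal.ofReal (Real.exp (a * U x))
      set p := ENNReal.ofReal (ψ x)
      set q := ENNReal.ofReal (1 - ψ x)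
      calc p * e + τ (V x) = p * e + (p + q) * τ (V x) := by rw [h2, one_mul]
        _ = p * e + q * τ (V x) + p * τ (V x) := by ring
        _ ≤ p * e + q * e + p * τ (V x) := by gcongr
        _ = (p + q) * e + p * τ (V x) := by ring
        _ = e + p * τ (V x) := by rw [h2, one_mul]
    · rw [hφ0 x h]
      simp only [ENNReal.ofReal_zero, zero_mul, add_zero, zero_add]
      gcongr
      exact hleτ _ _ h
  let F : (𝓧 → ℝ) → 𝓧 → ℝ≥0∞ := fun χ x =>
    ENNReal.ofReal (χ x) * (ENNReal.ofReal (Real.exp (a * U x)) * w (V x))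
  have hFm : ∀ {χ : 𝓧 → ℝ}, IsTest χ → Measurable (F χ) := fun hχ =>
    hχ.measurable.ennreal_ofReal.mul
      ((((hU.const_mul a).exp).ennreal_ofReal).mul (hw.comp hV))
  -- Restricting to bounded `τ` makes the threshold terms finite; they are equal by `heq` and can be
  -- cancelled.
  have hpart : ∀ A : Set E, MeasurableSet A → ∀ N : ℕ, (∀ v ∈ A, τ v ≤ N) →
      ∫⁻ x in V ⁻¹' A, F ψ x ∂ν ≤ ∫⁻ x in V ⁻¹' A, F φ x ∂ν := by
    intro A hA N hN
    set h : E → ℝ≥0∞ := A.indicator fun v => τ v * w v with hh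
    have hhm : Measurable h := (hτm.mul hw).indicator hA
    have hle : ∀ x, h (V x) ≤ N * w (V x) := by
      intro x
      by_cases hx : V x ∈ A
      · rw [hh, Set.indicator_of_mem hx]
        gcongr
        exact hN _ hx
      · rw [hh, Set.indicator_of_notMem hx]
        exact zero_le
    have hne : ∫⁻ x, ENNReal.ofReal (φ x) * h (V x) ∂ν ≠ ∞ := by
      refine ne_top_of_le_ne_top (ENNReal.mul_ne_top (ENNReal.natCast_ne_top N) hfin) ?_
      rw [← lintegral_const_mul (N : ℝ≥0∞) (show Measurable fun x => w (V x) from hw.comp hV)]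
      refine lintegral_mono fun x => ?_
      calc ENNReal.ofReal (φ x) * h (V x) ≤ 1 * h (V x) := by
            gcongr
            exact ENNReal.ofReal_le_one.2 (hφ.le_one x)
        _ ≤ N * w (V x) := by rw [one_mul]; exact hle x
    have hsum : ∫⁻ x in V ⁻¹' A, F ψ x ∂ν + ∫⁻ x, ENNReal.ofReal (φ x) * h (V x) ∂ν ≤
        ∫⁻ x in V ⁻¹' A, F φ x ∂ν + ∫⁻ x, ENNReal.ofReal (ψ x) * h (V x) ∂ν := by
      rw [← lintegral_indicator (hV hA), ← lintegral_indicator (hV hA),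
        ← lintegral_add_left ((hFm hψ).indicator (hV hA)),
        ← lintegral_add_left ((hFm hφ).indicator (hV hA))]
      refine lintegral_mono fun x => ?_
      by_cases hx : V x ∈ A
      · have hx' : x ∈ V ⁻¹' A := hx
        simp only [hh, Set.indicator_of_mem hx, Set.indicator_of_mem hx']
        have := mul_le_mul_left (hpt x) (w (V x))
        simp only [F]
        calc _ = (ENNReal.ofReal (ψ x) * ENNReal.ofReal (Real.exp (a * U x)) +
              ENNReal.ofReal (φ x) * τ (V x)) * w (V x) := by ring
          _ ≤ _ := this
          _ = _ := by ring
      · have hx' : x ∉ V ⁻¹' A := hx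
        simp [hh, Set.indicator_of_notMem hx, Set.indicator_of_notMem hx']
    rw [heq h hhm] at hsum
    exact (ENNReal.add_le_add_iff_right hne).1 hsum
  -- Over an infinite threshold `φ` never rejects, so by `heq` the test `ψ` vanishes there almost
  -- everywhere.
  have htop : ∫⁻ x in V ⁻¹' {v | τ v = ∞}, F ψ x ∂ν = 0 := by
    have hA : MeasurableSet {v | τ v = ∞} := hτm (measurableSet_singleton _)
    have hIm : Measurable fun x => {v | τ v = ∞}.indicator (fun _ => (1 : ℝ≥0∞)) (V x) :=
      (measurable_const.indicator hA).comp hV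
    have hφm := hφ.measurable
    have hψm := hψ.measurable
    have h1 := heq ({v | τ v = ∞}.indicator fun _ => 1) (measurable_const.indicator hA)
    have h2 : ∫⁻ x, ENNReal.ofReal (φ x) * ({v | τ v = ∞}.indicator (fun _ => 1) (V x)) ∂ν = 0 := by
      rw [lintegral_eq_zero_iff (by fun_prop)]
      refine ae_of_all _ fun x => ?_
      by_cases hx : f (U x) (V x)
      · have hnot : V x ∉ {v | τ v = ∞} := fun h =>
          (lt_of_le_of_lt (hτle _ _ hx) ENNReal.ofReal_lt_top).ne h
        simp [Set.indicator_of_notMem hnot]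
      · simp [hφ0 x hx]
    rw [h2, lintegral_eq_zero_iff (by fun_prop)] at h1
    rw [← lintegral_indicator (hV hA), lintegral_eq_zero_iff ((hFm hψ).indicator (hV hA))]
    filter_upwards [h1] with x hx
    by_cases hm : V x ∈ {v | τ v = ∞}
    · have hx' : x ∈ V ⁻¹' {v | τ v = ∞} := hm
      rw [Set.indicator_of_mem hm, mul_one] at hx
      simp only [Set.indicator_of_mem hx', F]
      rw [hx]
      simp
    · have hx' : x ∉ V ⁻¹' {v | τ v = ∞} := hm
      exact Set.indicator_of_notMem hx' _
  have hcover : (⋃ N : ℕ, V ⁻¹' {v | τ v ≤ N}) ∪ V ⁻¹' {v | τ v = ∞} = Set.univ := by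
    refine Set.eq_univ_of_forall fun x => ?_
    by_cases h : τ (V x) = ∞
    · exact Or.inr h
    · obtain ⟨N, hN⟩ := ENNReal.exists_nat_gt h
      exact Or.inl (Set.mem_iUnion.2 ⟨N, hN.le⟩)
  have hdir : Monotone fun N : ℕ => V ⁻¹' {v | τ v ≤ N} := by
    intro N N' h x hx
    exact (show τ (V x) ≤ N from hx).trans (by exact_mod_cast h)
  have hset : ∀ N : ℕ, MeasurableSet {v | τ v ≤ N} := fun N => hτm measurableSet_Iic
  calc ∫⁻ x, F ψ x ∂ν = (ν.withDensity (F ψ)) Set.univ := by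
        rw [withDensity_apply _ MeasurableSet.univ, Measure.restrict_univ]
    _ ≤ (ν.withDensity (F ψ)) (⋃ N : ℕ, V ⁻¹' {v | τ v ≤ N}) +
        (ν.withDensity (F ψ)) (V ⁻¹' {v | τ v = ∞}) := by
        rw [← hcover]; exact measure_union_le _ _
    _ = ⨆ N : ℕ, (ν.withDensity (F ψ)) (V ⁻¹' {v | τ v ≤ N}) := by
        rw [hdir.measure_iUnion, withDensity_apply _ (hV (show MeasurableSet {v | τ v = ∞} from hτm (measurableSet_singleton _))),
          htop,
          add_zero]
    _ ≤ ∫⁻ x, F φ x ∂ν := by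
        refine iSup_le fun N => ?_
        rw [withDensity_apply _ (hV (hset N))]
        exact (hpart _ (hset N) N fun v hv => hv).trans (setLIntegral_le_lintegral _ _)

/-- A one-sided test about one natural parameter of an exponential family is admissible if it
rejects for large values of the corresponding statistic, given the other statistics. -/
theorem isAdmissibleTest_of_monotone_section {𝓧 Θ ι : Type*} [MeasurableSpace 𝓧] [Fintype ι]
    {P : Θ → Measure 𝓧} {H K : Set Θ} {ν : Measure 𝓧} {U : 𝓧 → ℝ} {V : 𝓧 → ι → ℝ}
    (hU : Measurable U) (hV : Measurable V) {a : Θ → ℝ} {b : Θ → ι → ℝ}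
    (hP : ∀ θ ∈ H ∪ K, IsProbabilityMeasure (P θ) ∧ ∃ k : ℝ, 0 < k ∧
      P θ = ν.withDensity fun x => ENNReal.ofReal (k * Real.exp (a θ * U x + b θ ⬝ᵥ V x)))
    (hH : ∀ θ ∈ H, a θ = 0) (hK : ∀ θ ∈ K, 0 < a θ)
    (hH' : ∀ β : ι → ℝ, (∀ j, 0 < β j) → ∃ θ ∈ H, ∀ x, b θ ⬝ᵥ V x = β ⬝ᵥ V x)
    (hK' : ∀ s : ℝ, 0 < s → ∀ β : ι → ℝ, (∀ j, 0 < β j) →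
      ∃ θ ∈ K, a θ = s ∧ ∀ x, b θ ⬝ᵥ V x = β ⬝ᵥ V x)
    (hKH : ∀ θ ∈ K, ∃ θ' ∈ H, ∀ x, b θ' ⬝ᵥ V x = b θ ⬝ᵥ V x)
    {f : ℝ → (ι → ℝ) → Prop} (hf : ∀ r, MeasurableSet {v | f r v})
    (hmono : ∀ v r s, r ≤ s → f r v → f s v)
    {φ : 𝓧 → ℝ} (hφm : Measurable φ)
    (hφ1 : ∀ x, f (U x) (V x) → φ x = 1) (hφ0 : ∀ x, ¬ f (U x) (V x) → φ x = 0) :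
    IsAdmissibleTest P H K φ := by
  have hφ : IsTest φ := by
    refine ⟨hφm, fun x => ?_, fun x => ?_⟩ <;>
    · by_cases h : f (U x) (V x)
      · simp [hφ1 x h]
      · simp [hφ0 x h]
  refine ⟨hφ, ?_⟩
  rintro ⟨ψ, hψ, hHle, hKle, hstrict⟩
  set e : ℝ → (ι → ℝ) → 𝓧 → ℝ := fun s β x => Real.exp (s * U x + β ⬝ᵥ V x) with he
  have hem : ∀ s β, Measurable (e s β) := fun s β => by
    have : Continuous fun v : ι → ℝ => β ⬝ᵥ v := by fun_prop
    exact ((hU.const_mul s).add (this.measurable.comp hV)).exp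
  have he0 : ∀ s β x, 0 < e s β x := fun s β x => Real.exp_pos _
  have hint : ∀ θ ∈ H ∪ K, Integrable (e (a θ) (b θ)) ν := by
    intro θ hθ
    obtain ⟨hp, k, hk, hPθ⟩ := hP θ hθ
    have h1 : Integrable (fun x => k * e (a θ) (b θ) x) ν := by
      refine ⟨((hem _ _).const_mul k).aestronglyMeasurable, ?_⟩
      rw [hasFiniteIntegral_iff_ofReal (ae_of_all _ fun x => by have := he0 (a θ) (b θ) x; positivity)]
      have := hp.measure_univ
      rw [hPθ, withDensity_apply _ MeasurableSet.univ, Measure.restrict_univ] at this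
      rw [this]
      exact ENNReal.one_lt_top
    simpa [hk.ne'] using h1.const_mul k⁻¹
  have htest : ∀ {χ : 𝓧 → ℝ}, IsTest χ → ∀ {s β}, Integrable (e s β) ν →
      Integrable (fun x => χ x * e s β x) ν := by
    intro χ hχ s β h
    refine h.mono' (hχ.measurable.mul (hem s β)).aestronglyMeasurable (ae_of_all _ fun x => ?_)
    rw [Real.norm_eq_abs, abs_of_nonneg (mul_nonneg (hχ.nonneg x) (he0 s β x).le)]
    exact mul_le_of_le_one_left (he0 s β x).le (hχ.le_one x)
  have hE : ∀ θ ∈ H ∪ K, ∃ k : ℝ, 0 < k ∧ ∀ χ : 𝓧 → ℝ,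
      ∫ x, χ x ∂(P θ) = k * ∫ x, χ x * e (a θ) (b θ) x ∂ν := by
    intro θ hθ
    obtain ⟨hp, k, hk, hPθ⟩ := hP θ hθ
    refine ⟨k, hk, fun χ => ?_⟩
    rw [hPθ, integral_withDensity_eq_integral_toReal_smul
      ((hem (a θ) (b θ)).const_mul k).ennreal_ofReal (ae_of_all _ fun x => ENNReal.ofReal_lt_top),
      ← integral_const_mul]
    refine integral_congr_ae (ae_of_all _ fun x => ?_)
    have := he0 (a θ) (b θ) x
    simp only [smul_eq_mul, he] at this ⊢
    rw [ENNReal.toReal_ofReal (by positivity)]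
    ring
  have hcongr : ∀ {s : ℝ} {β β' : ι → ℝ}, (∀ x, β ⬝ᵥ V x = β' ⬝ᵥ V x) → e s β = e s β' := by
    intro s β β' h
    ext x
    simp only [he, h x]
  have hintH : ∀ β : ι → ℝ, (∀ j, 0 < β j) → Integrable (e 0 β) ν := by
    intro β hβ
    obtain ⟨θ, hθ, hb⟩ := hH' β hβ
    have := hint θ (Or.inl hθ)
    rwa [hH θ hθ, hcongr hb] at this
  have hintK : ∀ s : ℝ, 0 < s → ∀ β : ι → ℝ, (∀ j, 0 < β j) → Integrable (e s β) ν := by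
    intro s hs β hβ
    obtain ⟨θ, hθ, ha, hb⟩ := hK' s hs β hβ
    have := hint θ (Or.inr hθ)
    rwa [ha, hcongr hb] at this
  have hleH : ∀ β : ι → ℝ, (∀ j, 0 < β j) →
      ∫ x, ψ x * e 0 β x ∂ν ≤ ∫ x, φ x * e 0 β x ∂ν := by
    intro β hβ
    obtain ⟨θ, hθ, hb⟩ := hH' β hβ
    obtain ⟨k, hk, hk'⟩ := hE θ (Or.inl hθ)
    have := hHle θ hθ
    rw [hk', hk', hH θ hθ, hcongr hb] at this
    exact le_of_mul_le_mul_left this hk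
  have hleK : ∀ s : ℝ, 0 < s → ∀ β : ι → ℝ, (∀ j, 0 < β j) →
      ∫ x, φ x * e s β x ∂ν ≤ ∫ x, ψ x * e s β x ∂ν := by
    intro s hs β hβ
    obtain ⟨θ, hθ, ha, hb⟩ := hK' s hs β hβ
    obtain ⟨k, hk, hk'⟩ := hE θ (Or.inr hθ)
    have := hKle θ hθ
    rw [hk', hk', ha, hcongr hb] at this
    exact le_of_mul_le_mul_left this hk
  -- Dominated convergence: for `0 < s < 1`, `exp (s * U)` is at most `1` or `exp U`, according to
  -- the sign of `U`.
  have hcont : ∀ {χ : 𝓧 → ℝ}, IsTest χ → ∀ β : ι → ℝ, (∀ j, 0 < β j) →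
      Tendsto (fun s => ∫ x, χ x * e s β x ∂ν) (𝓝[>] 0) (𝓝 (∫ x, χ x * e 0 β x ∂ν)) := by
    intro χ hχ β hβ
    refine tendsto_integral_filter_of_dominated_convergence (fun x => e 0 β x + e 1 β x)
      (Eventually.of_forall fun s => (hχ.measurable.mul (hem s β)).aestronglyMeasurable) ?_
      ((hintH β hβ).add (hintK 1 one_pos β hβ)) (ae_of_all _ fun x => ?_)
    · filter_upwards [Ioo_mem_nhdsGT (one_pos : (0 : ℝ) < 1)] with s hs
      refine ae_of_all _ fun x => ?_
      rw [Real.norm_eq_abs, abs_of_nonneg (mul_nonneg (hχ.nonneg x) (he0 s β x).le)]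
      refine (mul_le_of_le_one_left (he0 s β x).le (hχ.le_one x)).trans ?_
      rcases le_total (U x) 0 with h | h
      · refine le_add_of_le_of_nonneg (Real.exp_le_exp.2 ?_) (he0 1 β x).le
        nlinarith [hs.1]
      · refine le_add_of_nonneg_of_le (he0 0 β x).le (Real.exp_le_exp.2 ?_)
        nlinarith [hs.2]
    · refine Tendsto.mono_left (Continuous.tendsto ?_ 0) nhdsWithin_le_nhds
      simp only [he]
      fun_prop
  have heq0 : ∀ β : ι → ℝ, (∀ j, 0 < β j) →
      ∫ x, ψ x * e 0 β x ∂ν = ∫ x, φ x * e 0 β x ∂ν := by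
    intro β hβ
    refine le_antisymm (hleH β hβ) (le_of_tendsto_of_tendsto (hcont hφ β hβ) (hcont hψ β hβ) ?_)
    filter_upwards [self_mem_nhdsWithin] with s hs
    exact hleK s hs β hβ
  have hlaw : ∀ h : (ι → ℝ) → ℝ≥0∞, Measurable h →
      ∫⁻ x, ENNReal.ofReal (ψ x) * h (V x) ∂ν = ∫⁻ x, ENNReal.ofReal (φ x) * h (V x) ∂ν := by
    intro h hh
    have he' : ∀ (β : ι → ℝ) x, Real.exp (β ⬝ᵥ V x) = e 0 β x := fun β x => by simp [he]
    refine lintegral_comp_eq_of_forall_integral_eq hV (fun β hβ => ?_) hψ hφ (fun β hβ => ?_) hh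
    · simp_rw [he']; exact hintH β hβ
    · simp_rw [he']; exact heq0 β hβ
  have hbm : ∀ β : ι → ℝ, Measurable fun v : ι → ℝ => ENNReal.ofReal (Real.exp (β ⬝ᵥ v)) :=
    fun β => Measurable.ennreal_ofReal (Continuous.measurable (by fun_prop))
  have htoReal : ∀ {χ : 𝓧 → ℝ}, IsTest χ → ∀ s β, ∫ x, χ x * e s β x ∂ν =
      (∫⁻ x, ENNReal.ofReal (χ x) * (ENNReal.ofReal (Real.exp (s * U x)) *
        ENNReal.ofReal (Real.exp (β ⬝ᵥ V x))) ∂ν).toReal := by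
    intro χ hχ s β
    rw [integral_eq_lintegral_of_nonneg_ae
      (ae_of_all _ fun x => mul_nonneg (hχ.nonneg x) (he0 s β x).le)
      (hχ.measurable.mul (hem s β)).aestronglyMeasurable]
    congr 1
    refine lintegral_congr fun x => ?_
    rw [← ENNReal.ofReal_mul (Real.exp_pos _).le, ← ENNReal.ofReal_mul (hχ.nonneg x),
      ← Real.exp_add]
  rcases hstrict with ⟨θ, hθ, hlt⟩ | ⟨θ, hθ, hlt⟩
  · obtain ⟨k, hk, hk'⟩ := hE θ (Or.inl hθ)
    rw [hk', hk', htoReal hψ, htoReal hφ, hH θ hθ] at hlt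
    simp only [zero_mul, Real.exp_zero, ENNReal.ofReal_one, one_mul] at hlt
    rw [hlaw _ (hbm (b θ))] at hlt
    exact lt_irrefl _ hlt
  · obtain ⟨k, hk, hk'⟩ := hE θ (Or.inr hθ)
    rw [hk', hk', htoReal hψ, htoReal hφ] at hlt
    refine absurd hlt (not_lt.2 (mul_le_mul_of_nonneg_left (ENNReal.toReal_mono ?_ ?_) hk.le))
    · have := (htest hφ (hint θ (Or.inr hθ))).lintegral_lt_top.ne
      refine ne_top_of_le_ne_top this (lintegral_mono fun x => le_of_eq ?_)
      rw [← ENNReal.ofReal_mul (Real.exp_pos _).le, ← ENNReal.ofReal_mul (hφ.nonneg x),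
        ← Real.exp_add]
    · refine lintegral_le_of_monotone_section hU hV hf hmono hψ hφ hφ1 hφ0 (hbm (b θ)) ?_ hlaw
        (hK θ hθ)
      -- The weight `exp (b θ ⬝ᵥ V)` is integrable because it is, up to a constant, the density of a
      -- null distribution.
      obtain ⟨θ', hθ', hb⟩ := hKH θ hθ
      have := hint θ' (Or.inl hθ')
      rw [hH θ' hθ', hcongr hb] at this
      simpa [he] using this.lintegral_lt_top.ne

end

/-! ### Monotonicity and measurability of step-down procedures -/

theorem leading_eq_iff {M : ℕ} {x : Fin M → ℝ} {S : Finset (Fin M)} (hS : S.Nonempty)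
    {j : Fin M} :
    leading x S hS = j ↔ j ∈ S ∧ (∀ k ∈ S, x k ≤ x j) ∧ ∀ k ∈ S, k < j → x k < x j := by
  rw [leading, Finset.min'_eq_iff]
  simp only [Finset.mem_filter]
  constructor
  · rintro ⟨⟨h1, h2⟩, h3⟩
    refine ⟨h1, h2, fun k hk hkj => ?_⟩
    by_contra hlt
    exact absurd (h3 k ⟨hk, fun l hl => (h2 l hl).trans (not_lt.1 hlt)⟩) (not_le.2 hkj)
  · rintro ⟨h1, h2, h3⟩
    refine ⟨⟨h1, h2⟩, fun k hk => ?_⟩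
    by_contra hlt
    exact absurd (hk.2 j h1) (not_le.2 (h3 k hk.1 (not_le.1 hlt)))

theorem mem_stepDownFrom_succ {M : ℕ} {G : ℕ → Finset (Fin M) → Prop} {x : Fin M → ℝ}
    {r m : ℕ} {S : Finset (Fin M)} {i : Fin M} :
    i ∈ stepDownFrom G x (r + 1) m S ↔ ∃ h : S.Nonempty, G m S ∧
      (i = leading x S h ∨ i ∈ stepDownFrom G x r (m + 1) (S.erase (leading x S h))) := by
  rw [stepDownFrom]
  split_ifs with h
  · simp [h.1, h.2]
  · simp only [Finset.notMem_empty, false_iff]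
    rintro ⟨h1, h2, -⟩
    exact h ⟨h1, h2⟩

theorem mem_of_mem_stepDownFrom {M : ℕ} {G : ℕ → Finset (Fin M) → Prop} {x : Fin M → ℝ}
    {r : ℕ} {i : Fin M} : ∀ {m : ℕ} {S : Finset (Fin M)}, i ∈ stepDownFrom G x r m S → i ∈ S := by
  induction r with
  | zero => intro m S h; simp [stepDownFrom] at h
  | succ r ih =>
    intro m S h
    obtain ⟨hS, -, h | h⟩ := mem_stepDownFrom_succ.1 h
    · rw [h]; exact ((leading_eq_iff hS).1 rfl).1
    · exact Finset.mem_of_mem_erase (ih h)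

/-- Raising the `i`-th coordinate relative to the others, which keep their differences, and
enlarging the rejection regions of the global tests that involve `i`, keeps `i` rejected. -/
theorem mem_stepDownFrom_mono {M : ℕ} {G G' : ℕ → Finset (Fin M) → Prop} {x y : Fin M → ℝ}
    {i : Fin M} {r : ℕ} (hG : ∀ m S, i ∈ S → G m S → G' m S) {s : ℝ}
    (hne : ∀ j, j ≠ i → y j = x j + s) (hi : x i + s ≤ y i) :
    ∀ {m : ℕ} {S : Finset (Fin M)}, i ∈ stepDownFrom G x r m S → i ∈ stepDownFrom G' y r m S := by
  induction r with
  | zero => intro m S h; simp [stepDownFrom] at h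
  | succ r ih =>
    intro m S h
    have hiS := mem_of_mem_stepDownFrom h
    obtain ⟨hS, hGS, h⟩ := mem_stepDownFrom_succ.1 h
    refine mem_stepDownFrom_succ.2 ⟨hS, hG m S hiS hGS, ?_⟩
    obtain ⟨hyS, hy1, hy2⟩ := (leading_eq_iff (x := y) hS).1 rfl
    set k := leading y S hS with hk
    by_cases hki : k = i
    · exact Or.inl hki.symm
    · right
      have hle : ∀ l, x l + s ≤ y l := fun l => by
        by_cases hl : l = i
        · rw [hl]; exact hi
        · exact (hne l hl).ge
      -- A leader `k ≠ i` at `y` already led at `x`: passing from `x` to `y` only improved `i`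
      -- relative to the others, whose order and ties are unchanged. Both runs thus remove the same
      -- index.
      have hlead : leading x S hS = k := by
        refine (leading_eq_iff hS).2 ⟨hyS, fun l hl => ?_, fun l hl hlk => ?_⟩
        · linarith [hle l, hy1 l hl, hne k hki]
        · linarith [hle l, hy2 l hl hlk, hne k hki]
      rw [hlead] at h
      exact h.elim (fun h => absurd h.symm hki) ih

theorem mem_stepDown_mono {M : ℕ} {G G' : ℕ → Finset (Fin M) → Prop} {x y : Fin M → ℝ}
    {i : Fin M} (hG : ∀ m S, i ∈ S → G m S → G' m S) {s : ℝ}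
    (hne : ∀ j, j ≠ i → y j = x j + s) (hi : x i + s ≤ y i) (h : i ∈ stepDown G x) :
    i ∈ stepDown G' y :=
  mem_stepDownFrom_mono hG hne hi h

theorem measurableSet_mem_stepDown {𝓧 : Type*} [MeasurableSpace 𝓧] {M : ℕ}
    {G : 𝓧 → ℕ → Finset (Fin M) → Prop} {x : 𝓧 → Fin M → ℝ}
    (hG : ∀ m S, MeasurableSet {ω | G ω m S}) (hx : Measurable x) (i : Fin M) :
    MeasurableSet {ω | i ∈ stepDown (G ω) (x ω)} := by
  have hxj : ∀ j, Measurable fun ω => x ω j := fun j => (measurable_pi_apply j).comp hx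
  suffices h : ∀ r m S, MeasurableSet {ω | i ∈ stepDownFrom (G ω) (x ω) r m S} from h _ _ _
  intro r
  induction r with
  | zero => intro m S; simp [stepDownFrom]
  | succ r ih =>
    intro m S
    by_cases hS : S.Nonempty
    · have : {ω | i ∈ stepDownFrom (G ω) (x ω) (r + 1) m S} = {ω | G ω m S} ∩
          ⋃ j, ({ω | j ∈ S ∧ (∀ k ∈ S, x ω k ≤ x ω j) ∧ ∀ k ∈ S, k < j → x ω k < x ω j} ∩
            {ω | i = j ∨ i ∈ stepDownFrom (G ω) (x ω) r (m + 1) (S.erase j)}) := by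
        ext ω
        simp only [mem_stepDownFrom_succ, Set.mem_inter_iff, Set.mem_iUnion, Set.mem_ofPred_eq,
          hS, exists_true_left, ← leading_eq_iff hS]
        simp
      rw [this]
      refine (hG m S).inter (MeasurableSet.iUnion fun j => MeasurableSet.inter ?_ ?_)
      · have h1 : MeasurableSet {ω | ∀ k ∈ S, x ω k ≤ x ω j} := by
          simp only [Set.ofPred_forall]
          exact MeasurableSet.iInter fun k => MeasurableSet.iInter fun _ =>
            measurableSet_le (hxj k) (hxj j)
        have h2 : MeasurableSet {ω | ∀ k ∈ S, k < j → x ω k < x ω j} := by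
          simp only [Set.ofPred_forall]
          exact MeasurableSet.iInter fun k => MeasurableSet.iInter fun _ =>
            MeasurableSet.iInter fun _ => measurableSet_lt (hxj k) (hxj j)
        exact (MeasurableSet.const _).inter (h1.inter h2)
      · exact MeasurableSet.union (MeasurableSet.const _) (ih _ _)
    · have : {ω | i ∈ stepDownFrom (G ω) (x ω) (r + 1) m S} = ∅ := by
        ext ω
        simp [mem_stepDownFrom_succ, hS]
      rw [this]
      exact MeasurableSet.empty

/-! ### Likelihood ratio tests and Gaussian quadratic forms -/

/-- A factor `r` common to all parameters cancels in the likelihood ratio. Allowing two sample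
spaces also covers the passage to sufficient statistics, with `r = 1`. -/
theorem LRTRejects.of_likelihood_le {𝓧 𝓨 Θ : Type*} {L : Θ → 𝓧 → ℝ} {L' : Θ → 𝓨 → ℝ} {H K : Set Θ}
    {c r : ℝ} (hr : 0 ≤ r) {x : 𝓧} {y : 𝓨} (hH : ∀ θ ∈ H, L' θ y ≤ r * L θ x)
    (hK : ∀ θ ∈ H ∪ K, r * L θ x ≤ L' θ y) (h : LRTRejects L H K c x) :
    LRTRejects L' H K c y := by
  unfold LRTRejects at h ⊢
  calc _ ≤ ENNReal.ofReal (Real.exp (c / 2)) *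
        (ENNReal.ofReal r * ⨆ θ ∈ H, ENNReal.ofReal (L θ x)) := by
        gcongr
        refine iSup₂_le fun θ hθ => ?_
        refine (ENNReal.ofReal_le_ofReal (hH θ hθ)).trans ?_
        rw [ENNReal.ofReal_mul hr]
        gcongr
        exact le_iSup₂ (f := fun θ (_ : θ ∈ H) => ENNReal.ofReal (L θ x)) θ hθ
    _ = ENNReal.ofReal r * (ENNReal.ofReal (Real.exp (c / 2)) *
        ⨆ θ ∈ H, ENNReal.ofReal (L θ x)) := by ring
    _ ≤ ENNReal.ofReal r * ⨆ θ ∈ H ∪ K, ENNReal.ofReal (L θ x) := by gcongr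
    _ ≤ _ := by
        simp_rw [ENNReal.mul_iSup]
        refine iSup₂_mono fun θ hθ => ?_
        rw [← ENNReal.ofReal_mul hr]
        exact ENNReal.ofReal_le_ofReal (hK θ hθ)

/-- The suprema run over uncountable families, but a supremum of continuous functions is lower
semicontinuous. -/
theorem measurableSet_LRTRejects {𝓧 Θ : Type*} [TopologicalSpace 𝓧] [MeasurableSpace 𝓧]
    [OpensMeasurableSpace 𝓧] {L : Θ → 𝓧 → ℝ} {H K : Set Θ} {c : ℝ}
    (hL : ∀ θ ∈ H ∪ K, Continuous (L θ)) : MeasurableSet {x | LRTRejects L H K c x} := by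
  have h : ∀ A : Set Θ, A ⊆ H ∪ K → Measurable fun x => ⨆ θ ∈ A, ENNReal.ofReal (L θ x) :=
    fun A hA => (lowerSemicontinuous_biSup fun θ hθ =>
      (ENNReal.continuous_ofReal.comp (hL θ (hA hθ))).lowerSemicontinuous).measurable
  exact measurableSet_le ((h H Set.subset_union_left).const_mul _) (h _ subset_rfl)

theorem dotProduct_inv_mulVec_sub {ι : Type*} [Fintype ι] [DecidableEq ι] {Γ : Matrix ι ι ℝ}
    (hΓ : Γ.PosDef) (x μ : ι → ℝ) :
    (x - μ) ⬝ᵥ (Γ⁻¹ *ᵥ (x - μ)) =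
      x ⬝ᵥ (Γ⁻¹ *ᵥ x) - 2 * ((Γ⁻¹ *ᵥ x) ⬝ᵥ μ) + μ ⬝ᵥ (Γ⁻¹ *ᵥ μ) := by
  have ht : (Γ⁻¹)ᵀ = Γ⁻¹ := by simpa [Matrix.IsHermitian] using hΓ.inv.isHermitian
  have h1 : x ⬝ᵥ (Γ⁻¹ *ᵥ μ) = (Γ⁻¹ *ᵥ x) ⬝ᵥ μ := by
    rw [Matrix.dotProduct_mulVec, ← Matrix.mulVec_transpose, ht]
  rw [Matrix.mulVec_sub, sub_dotProduct, dotProduct_sub, dotProduct_sub, h1,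
    dotProduct_comm μ (Γ⁻¹ *ᵥ x)]
  ring

theorem posDef_isUnit_det {ι : Type*} [Fintype ι] [DecidableEq ι] {Γ : Matrix ι ι ℝ}
    (hΓ : Γ.PosDef) : IsUnit Γ.det :=
  isUnit_iff_ne_zero.2 hΓ.det_pos.ne'

theorem mulVec_add_smul_single {ι : Type*} [Fintype ι] [DecidableEq ι] (Γ : Matrix ι ι ℝ)
    (w : ι → ℝ) (i : ι) (γ : ℝ) :
    Γ *ᵥ (w + γ • Pi.single i 1) = Γ *ᵥ w + γ • fun j => Γ j i := by
  rw [Matrix.mulVec_add, Matrix.mulVec_smul, Matrix.mulVec_single_one]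
  rfl

theorem inv_mulVec_add_smul_col {ι : Type*} [Fintype ι] [DecidableEq ι] {Γ : Matrix ι ι ℝ}
    (hΓ : Γ.PosDef) (x : ι → ℝ) (i : ι) (γ : ℝ) :
    Γ⁻¹ *ᵥ (x + γ • fun j => Γ j i) = Γ⁻¹ *ᵥ x + γ • Pi.single i 1 := by
  have h : Γ *ᵥ (Γ⁻¹ *ᵥ x) = x := by
    rw [Matrix.mulVec_mulVec, Matrix.mul_nonsing_inv _ (posDef_isUnit_det hΓ), Matrix.one_mulVec]
  conv_lhs => rw [← h, ← mulVec_add_smul_single]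
  rw [Matrix.mulVec_mulVec, Matrix.nonsing_inv_mul _ (posDef_isUnit_det hΓ), Matrix.one_mulVec]

/-- Applied to `V`, whose `i`-th entry is zero: the tested mean can be reset without affecting the
nuisance part of the exponent. -/
theorem update_dotProduct_of_eq_zero {ι : Type*} [Fintype ι] [DecidableEq ι] {i : ι} {v : ι → ℝ}
    (hv : v i = 0) (β : ι → ℝ) (s : ℝ) : Function.update β i s ⬝ᵥ v = β ⬝ᵥ v := by
  refine Finset.sum_congr rfl fun j _ => ?_
  by_cases hj : j = i
  · rw [hj, hv, mul_zero, mul_zero]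
  · rw [Function.update_of_ne hj]

theorem continuous_normalDensity {ι : Type*} [Fintype ι] [DecidableEq ι] (Γ : Matrix ι ι ℝ)
    (μ : ι → ℝ) : Continuous (normalDensity Γ μ) := by
  unfold normalDensity
  fun_prop

/-- The quadratic form at `e_i - e_j` equals `2 * (v - c)`, so `c < v`. Without a second index, `s`
is the diagonal entry. This is where the intraclass structure enters. -/
theorem exists_intraclass_offDiag_le {M : ℕ} {v c : ℝ} (hΓ : (intraclass M v c).PosDef)
    (i : Fin M) :
    ∃ s, (∀ j, j ≠ i → intraclass M v c j i = s) ∧ s ≤ intraclass M v c i i := by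
  by_cases h : ∃ j, j ≠ i
  · obtain ⟨j, hj⟩ := h
    refine ⟨c, fun k hk => by simp [intraclass, hk], ?_⟩
    have hz : (Pi.single i (1 : ℝ) - Pi.single j 1 : Fin M → ℝ) ≠ 0 := by
      intro h0
      have := congrFun h0 i
      simp [hj.symm] at this
    have := hΓ.dotProduct_mulVec_pos hz
    simp only [star_trivial, Matrix.mulVec_sub, sub_dotProduct, dotProduct_sub,
      Matrix.mulVec_single_one, single_one_dotProduct, Matrix.col_apply] at this
    simp [intraclass, hj, hj.symm] at this ⊢
    linarith
  · push Not at h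
    exact ⟨_, fun j hj => absurd (h j) hj, le_rfl⟩

/-! ### Known covariance matrix -/

/-- Since `i ∈ S`, the column restricted to `S` is a column of the submatrix, and the inverse
submatrix sends it to a unit vector. The likelihood thus gains a factor free of `μ` times `exp (γ *
μ i)`. -/
theorem globalRejects_add_col {M : ℕ} {Γ : Matrix (Fin M) (Fin M) ℝ} (hΓ : Γ.PosDef) {c γ : ℝ}
    (hγ : 0 ≤ γ) {x : Fin M → ℝ} {S : Finset (Fin M)} {i : Fin M} (hi : i ∈ S)
    (h : globalRejects Γ c x S) : globalRejects Γ c (x + γ • fun j => Γ j i) S := by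
  unfold globalRejects at h ⊢
  set A : Matrix S S ℝ := Γ.submatrix (fun j : S => (j : Fin M)) fun j => j with hA
  have hApd : A.PosDef := hΓ.submatrix Subtype.val_injective
  set x' : S → ℝ := fun j => x j
  set y' : S → ℝ := fun j => (x + γ • fun j => Γ j i) (j : Fin M) with hy'
  have hy : y' = x' + γ • fun j => A j ⟨i, hi⟩ := by ext j; rfl
  have hL : ∀ μ : S → ℝ, normalDensity A μ y' =
      Real.exp (-(1 / 2) * (y' ⬝ᵥ (A⁻¹ *ᵥ y') - x' ⬝ᵥ (A⁻¹ *ᵥ x'))) * normalDensity A μ x' *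
        Real.exp (γ * μ ⟨i, hi⟩) := by
    intro μ
    have h1 : (A⁻¹ *ᵥ y') ⬝ᵥ μ = (A⁻¹ *ᵥ x') ⬝ᵥ μ + γ * μ ⟨i, hi⟩ := by
      rw [hy, inv_mulVec_add_smul_col hApd, add_dotProduct, smul_dotProduct,
        single_one_dotProduct, smul_eq_mul]
    unfold normalDensity
    rw [dotProduct_inv_mulVec_sub hApd, dotProduct_inv_mulVec_sub hApd, h1, mul_left_comm,
      mul_assoc, mul_assoc, ← Real.exp_add, ← Real.exp_add]
    congr 2
    ring
  have hpos : ∀ μ : S → ℝ, 0 ≤ normalDensity A μ x' := fun μ =>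
    mul_nonneg (inv_nonneg.2 (Real.sqrt_nonneg _)) (Real.exp_pos _).le
  refine h.of_likelihood_le (Real.exp_pos
    (-(1 / 2) * (y' ⬝ᵥ (A⁻¹ *ᵥ y') - x' ⬝ᵥ (A⁻¹ *ᵥ x')))).le (fun μ hμ => ?_) fun μ hμ => ?_
  · rw [Set.mem_singleton_iff.1 hμ, hL]
    simp
  · rw [hL]
    refine le_mul_of_one_le_right (mul_nonneg (Real.exp_pos _).le (hpos μ)) (Real.one_le_exp ?_)
    rcases hμ with hμ | hμ
    · simp [Set.mem_singleton_iff.1 hμ]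
    · exact mul_nonneg hγ (hμ.1 _)

theorem mem_lrsd_add_col {M : ℕ} {v c : ℝ} (hΓ : (intraclass M v c).PosDef) {C : ℕ → ℝ}
    {i : Fin M} {x : Fin M → ℝ} {γ : ℝ} (hγ : 0 ≤ γ) (h : i ∈ lrsd (intraclass M v c) C x) :
    i ∈ lrsd (intraclass M v c) C (x + γ • fun j => intraclass M v c j i) := by
  obtain ⟨s, hs, hsi⟩ := exists_intraclass_offDiag_le hΓ i
  refine mem_stepDown_mono (s := γ * s) (fun m S hi => globalRejects_add_col hΓ hγ hi)
    (fun j hj => ?_) ?_ h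
  · simp [hs j hj]
  · simpa using mul_le_mul_of_nonneg_left hsi hγ

theorem measurableSet_mem_lrsd {M : ℕ} (Γ : Matrix (Fin M) (Fin M) ℝ) (C : ℕ → ℝ) (i : Fin M) :
    MeasurableSet {x : Fin M → ℝ | i ∈ lrsd Γ C x} := by
  refine measurableSet_mem_stepDown (fun m S => ?_) measurable_id i
  have hr : Measurable fun (x : Fin M → ℝ) (j : S) => x j :=
    measurable_pi_lambda _ fun j => measurable_pi_apply _
  exact hr (measurableSet_LRTRejects fun μ _ => continuous_normalDensity _ μ)

theorem isAdmissibleTest_lrsdTest {M : ℕ} {v c : ℝ} (hΓ : (intraclass M v c).PosDef)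
    (C : ℕ → ℝ) (i : Fin M) {Ω : Set (EuclideanSpace ℝ (Fin M))}
    (hΩ : Ω = {μ | ∀ j, 0 ≤ μ j} ∨ Ω = Set.univ) :
    IsAdmissibleTest (fun μ => multivariateGaussian μ (intraclass M v c))
      {μ | μ ∈ Ω ∧ μ i = 0} {μ | μ ∈ Ω ∧ 0 < μ i} (lrsdTest (intraclass M v c) C i) := by
  set Γ := intraclass M v c with hΓdef
  obtain ⟨k, hk, hkP⟩ := exists_multivariateGaussian_eq_withDensity hΓ
  set W : EuclideanSpace ℝ (Fin M) → Fin M → ℝ := fun x => Γ⁻¹ *ᵥ x.ofLp with hW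
  have hWc : Continuous W := by fun_prop
  set U : EuclideanSpace ℝ (Fin M) → ℝ := fun x => W x i with hU
  set V : EuclideanSpace ℝ (Fin M) → Fin M → ℝ := fun x => W x - U x • Pi.single i 1 with hV
  have hUc : Continuous U := by fun_prop
  have hVc : Continuous V := by fun_prop
  have hVi : ∀ x, V x i = 0 := fun x => by simp [hV, hU]
  have hVU : ∀ x, V x + U x • Pi.single i 1 = W x := fun x => by simp [hV]
  have hΩpos : ∀ μ : EuclideanSpace ℝ (Fin M), (∀ j, 0 ≤ μ j) → μ ∈ Ω := by
    rintro μ hμ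
    rcases hΩ with rfl | rfl
    · exact hμ
    · trivial
  have hΩupd : ∀ μ ∈ Ω, WithLp.toLp 2 (Function.update μ.ofLp i 0) ∈ Ω := by
    rintro μ hμ
    rcases hΩ with rfl | rfl
    · intro j
      by_cases hj : j = i
      · simp [hj]
      · simpa [Function.update_of_ne hj] using hμ j
    · trivial
  have hΓW : ∀ x, Γ *ᵥ W x = x.ofLp := fun x => by
    rw [hW, Matrix.mulVec_mulVec, Matrix.mul_nonsing_inv _ (posDef_isUnit_det hΓ),
      Matrix.one_mulVec]
  have hset : MeasurableSet {x : EuclideanSpace ℝ (Fin M) | i ∈ lrsd Γ C x} :=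
    (WithLp.measurable_ofLp 2 (Fin M → ℝ)) (measurableSet_mem_lrsd Γ C i)
  refine isAdmissibleTest_of_monotone_section
    -- The base measure absorbs the part of the Gaussian exponent that is quadratic in `x`.
    (ν := volume.withDensity fun x : EuclideanSpace ℝ (Fin M) =>
      ENNReal.ofReal (Real.exp (-(1 / 2) * (x.ofLp ⬝ᵥ W x))))
    hUc.measurable hVc.measurable (a := fun μ => μ i) (b := fun μ => μ.ofLp)
    (f := fun u v => i ∈ lrsd Γ C (Γ *ᵥ (v + u • Pi.single i 1)))
    (fun μ _ => ⟨inferInstance, k * Real.exp (-(1 / 2) * (μ.ofLp ⬝ᵥ (Γ⁻¹ *ᵥ μ.ofLp))),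
      by positivity, ?_⟩)
    (fun μ hμ => hμ.2) (fun μ hμ => hμ.2) (fun β hβ => ?_) (fun s hs β hβ => ?_) (fun μ hμ => ?_)
    (fun r => ?_) (fun v r s hrs h => ?_) ?_ (fun x hx => ?_) (fun x hx => ?_)
  · rw [hkP, ← withDensity_mul]
    · congr 1
      ext x
      rw [Pi.mul_apply, ← ENNReal.ofReal_mul (Real.exp_pos _).le, dotProduct_inv_mulVec_sub hΓ]
      have h1 : μ i * U x + μ.ofLp ⬝ᵥ V x = W x ⬝ᵥ μ.ofLp := by
        rw [← hVU x, add_dotProduct, smul_dotProduct, single_one_dotProduct,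
          dotProduct_comm (V x), smul_eq_mul]
        ring
      rw [h1]
      congr 1
      rw [mul_assoc k, mul_left_comm, ← Real.exp_add, ← Real.exp_add]
      congr 2
      ring
    · exact Measurable.ennreal_ofReal (Continuous.measurable (by fun_prop))
    · exact Measurable.ennreal_ofReal (Continuous.measurable (by fun_prop))
  · refine ⟨WithLp.toLp 2 (Function.update β i 0), ⟨hΩpos _ fun j => ?_, by simp⟩, fun x =>
      update_dotProduct_of_eq_zero (hVi x) β 0⟩
    by_cases hj : j = i
    · simp [hj]
    · simpa [Function.update_of_ne hj] using (hβ j).le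
  · refine ⟨WithLp.toLp 2 (Function.update β i s), ⟨hΩpos _ fun j => ?_, by simpa using hs⟩,
      by simp, fun x => update_dotProduct_of_eq_zero (hVi x) β s⟩
    by_cases hj : j = i
    · simpa [hj] using hs.le
    · simpa [Function.update_of_ne hj] using (hβ j).le
  · exact ⟨WithLp.toLp 2 (Function.update μ.ofLp i 0), ⟨hΩupd μ hμ.1, by simp⟩, fun x =>
      update_dotProduct_of_eq_zero (hVi x) μ.ofLp 0⟩
  · have : Continuous fun v : Fin M → ℝ => Γ *ᵥ (v + r • Pi.single i 1) := by fun_prop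
    exact this.measurable (measurableSet_mem_lrsd Γ C i)
  · have : v + s • Pi.single i (1 : ℝ) = (v + r • Pi.single i 1) + (s - r) • Pi.single i 1 := by
      rw [sub_smul]; abel
    show i ∈ lrsd Γ C _
    rw [this, mulVec_add_smul_single]
    exact mem_lrsd_add_col hΓ (sub_nonneg.2 hrs) h
  · exact Measurable.ite hset measurable_const measurable_const
  · rw [hVU, hΓW] at hx
    exact if_pos hx
  · rw [hVU, hΓW] at hx
    exact if_neg hx

/-! ### Unknown scale factor -/

/-- The sum of squares `∑ X_α' Γ⁻¹ X_α` of a sample. -/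
noncomputable def sampleSumSq {M n : ℕ} (Γ : Matrix (Fin M) (Fin M) ℝ)
    (X : Fin n → EuclideanSpace ℝ (Fin M)) : ℝ :=
  ∑ α, (X α).ofLp ⬝ᵥ (Γ⁻¹ *ᵥ (X α).ofLp)

/-- The likelihood of a sample of size `n` as a function of the sufficient statistics
`p.1 = Γ⁻¹ X̄` and `p.2 = ∑ X_α' Γ⁻¹ X_α`. -/
noncomputable def sufficientLikelihood {M : ℕ} (n : ℕ) (Γ : Matrix (Fin M) (Fin M) ℝ)
    (θ : (Fin M → ℝ) × ℝ) (p : (Fin M → ℝ) × ℝ) : ℝ :=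
  (Real.sqrt ((2 * Real.pi) ^ Fintype.card (Fin M) * (θ.2 • Γ).det))⁻¹ ^ n *
    Real.exp (-(1 / 2) * (θ.2⁻¹ * (p.2 - 2 * (n * (p.1 ⬝ᵥ θ.1)) +
      n * (θ.1 ⬝ᵥ (Γ⁻¹ *ᵥ θ.1)))))

/-- The rejection set of the step-down procedure with unknown scale factor, as a function of the
sufficient statistics. -/
noncomputable def lrsdSufficient {M : ℕ} (n : ℕ) (Γ : Matrix (Fin M) (Fin M) ℝ) (C : ℕ → ℝ)
    (p : (Fin M → ℝ) × ℝ) : Finset (Fin M) :=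
  stepDown (fun m S => LRTRejects (sufficientLikelihood n Γ)
    {θ : (Fin M → ℝ) × ℝ | 0 < θ.2 ∧ ∀ j ∈ S, θ.1 j = 0}
    {θ : (Fin M → ℝ) × ℝ | 0 < θ.2 ∧ (∀ j ∈ S, 0 ≤ θ.1 j) ∧ ∃ j ∈ S, θ.1 j ≠ 0} (C m) p)
    (Γ *ᵥ p.1)

theorem inv_smul_posDef {ι : Type*} [Fintype ι] [DecidableEq ι] {Γ : Matrix ι ι ℝ}
    (hΓ : Γ.PosDef) {s : ℝ} (hs : 0 < s) : (s • Γ)⁻¹ = s⁻¹ • Γ⁻¹ := by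
  have := Matrix.inv_smul' Γ (Units.mk0 s hs.ne') (posDef_isUnit_det hΓ)
  simpa [Units.smul_def] using this

theorem sum_dotProduct_inv_mulVec_sub {M n : ℕ} (hn : n ≠ 0) {Γ : Matrix (Fin M) (Fin M) ℝ}
    (hΓ : Γ.PosDef) {s : ℝ} (hs : 0 < s) (μ : Fin M → ℝ) (X : Fin n → EuclideanSpace ℝ (Fin M)) :
    ∑ α, ((X α).ofLp - μ) ⬝ᵥ ((s • Γ)⁻¹ *ᵥ ((X α).ofLp - μ)) =
      s⁻¹ * (sampleSumSq Γ X - 2 * (n * ((Γ⁻¹ *ᵥ sampleMean X) ⬝ᵥ μ)) +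
        n * (μ ⬝ᵥ (Γ⁻¹ *ᵥ μ))) := by
  have hmean : ∑ α, (Γ⁻¹ *ᵥ (X α).ofLp) ⬝ᵥ μ = n * ((Γ⁻¹ *ᵥ sampleMean X) ⬝ᵥ μ) := by
    have h1 : ∑ α, (X α).ofLp = (n : ℝ) • sampleMean X := by
      ext j
      have : (n : ℝ) ≠ 0 := by exact_mod_cast hn
      simp [sampleMean, mul_div_cancel₀ _ this]
    rw [← sum_dotProduct, ← Matrix.mulVec_sum, h1, Matrix.mulVec_smul, smul_dotProduct, smul_eq_mul]
  simp_rw [inv_smul_posDef hΓ hs, Matrix.smul_mulVec, dotProduct_smul, smul_eq_mul,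
    dotProduct_inv_mulVec_sub hΓ]
  rw [← Finset.mul_sum, Finset.sum_add_distrib, Finset.sum_sub_distrib, ← Finset.mul_sum, hmean]
  simp [sampleSumSq]

theorem sampleLikelihood_eq {M n : ℕ} (hn : n ≠ 0) {Γ : Matrix (Fin M) (Fin M) ℝ}
    (hΓ : Γ.PosDef) {θ : (Fin M → ℝ) × ℝ} (hθ : 0 < θ.2) (X : Fin n → EuclideanSpace ℝ (Fin M)) :
    sampleLikelihood Γ θ X =
      sufficientLikelihood n Γ θ (Γ⁻¹ *ᵥ sampleMean X, sampleSumSq Γ X) := by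
  unfold sampleLikelihood sufficientLikelihood normalDensity
  rw [Finset.prod_mul_distrib, ← Real.exp_sum, ← Finset.mul_sum,
    sum_dotProduct_inv_mulVec_sub hn hΓ hθ]
  simp

/-- The likelihood factors through the sufficient statistics when `σ² > 0`, which both hypotheses of
each global test require. -/
theorem lrsdSample_eq {M n : ℕ} (hn : n ≠ 0) {Γ : Matrix (Fin M) (Fin M) ℝ} (hΓ : Γ.PosDef)
    (C : ℕ → ℝ) (X : Fin n → EuclideanSpace ℝ (Fin M)) :
    lrsdSample Γ C X = lrsdSufficient n Γ C (Γ⁻¹ *ᵥ sampleMean X, sampleSumSq Γ X) := by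
  unfold lrsdSample lrsdSufficient
  rw [Matrix.mulVec_mulVec, Matrix.mul_nonsing_inv _ (posDef_isUnit_det hΓ), Matrix.one_mulVec]
  congr 1
  ext m S
  have h : ∀ θ : (Fin M → ℝ) × ℝ, 0 < θ.2 → _ := fun θ hθ => sampleLikelihood_eq hn hΓ hθ X
  constructor
  · refine LRTRejects.of_likelihood_le zero_le_one (fun θ hθ => ?_) fun θ hθ => ?_
    · rw [one_mul, h θ hθ.1]
    · rw [one_mul, h θ (hθ.elim And.left And.left)]
  · refine LRTRejects.of_likelihood_le zero_le_one (fun θ hθ => ?_) fun θ hθ => ?_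
    · rw [one_mul, h θ hθ.1]
    · rw [one_mul, h θ (hθ.elim And.left And.left)]

/-- The sum of squares stays fixed while `Γ⁻¹ X̄` moves, so the new pair need not come from any
sample. This is why the procedure is extended to arbitrary values of the sufficient statistics. -/
theorem mem_lrsdSufficient_add_single {M n : ℕ} {v c : ℝ} (hΓ : (intraclass M v c).PosDef)
    {C : ℕ → ℝ} {i : Fin M} {w : Fin M → ℝ} {t γ : ℝ} (hγ : 0 ≤ γ)
    (h : i ∈ lrsdSufficient n (intraclass M v c) C (w, t)) :
    i ∈ lrsdSufficient n (intraclass M v c) C (w + γ • Pi.single i 1, t) := by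
  obtain ⟨s, hs, hsi⟩ := exists_intraclass_offDiag_le hΓ i
  unfold lrsdSufficient at h ⊢
  refine mem_stepDown_mono (s := γ * s) (fun m S hi => ?_) (fun j hj => ?_) ?_ h
  · have hL : ∀ θ : (Fin M → ℝ) × ℝ, sufficientLikelihood n (intraclass M v c) θ
        (w + γ • Pi.single i 1, t) = 1 * sufficientLikelihood n (intraclass M v c) θ (w, t) *
          Real.exp (θ.2⁻¹ * (n * (γ * θ.1 i))) := by
      intro θ
      unfold sufficientLikelihood
      rw [one_mul, mul_assoc _ (Real.exp _), ← Real.exp_add]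
      simp only [add_dotProduct, smul_dotProduct, single_one_dotProduct, smul_eq_mul]
      congr 2
      ring
    refine LRTRejects.of_likelihood_le zero_le_one (fun θ hθ => ?_) fun θ hθ => ?_
    · rw [hL, hθ.2 i hi]
      simp
    · have h0 : 0 ≤ θ.1 i := hθ.elim (fun h => (h.2 i hi).ge) fun h => h.2.1 i hi
      have h2 : 0 < θ.2 := hθ.elim And.left And.left
      rw [hL]
      refine le_mul_of_one_le_right ?_ (Real.one_le_exp (by positivity))
      unfold sufficientLikelihood
      positivity
  · rw [mulVec_add_smul_single]
    simp [hs j hj]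
  · rw [mulVec_add_smul_single]
    simpa using mul_le_mul_of_nonneg_left hsi hγ

theorem measurableSet_mem_lrsdSufficient {M : ℕ} (n : ℕ) (Γ : Matrix (Fin M) (Fin M) ℝ)
    (C : ℕ → ℝ) (i : Fin M) :
    MeasurableSet {p : (Fin M → ℝ) × ℝ | i ∈ lrsdSufficient n Γ C p} := by
  refine measurableSet_mem_stepDown (fun m S => ?_) (Continuous.measurable (by fun_prop)) i
  refine measurableSet_LRTRejects fun θ _ => ?_
  unfold sufficientLikelihood
  fun_prop

theorem exists_pi_multivariateGaussian_eq_withDensity {M n : ℕ} (hn : n ≠ 0)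
    {Γ : Matrix (Fin M) (Fin M) ℝ} (hΓ : Γ.PosDef) {s : ℝ} (hs : 0 < s)
    (μ : EuclideanSpace ℝ (Fin M)) :
    ∃ k : ℝ, 0 < k ∧ (Measure.pi fun _ : Fin n => multivariateGaussian μ (s • Γ)) =
      (Measure.pi fun _ => volume).withDensity fun X => ENNReal.ofReal (k *
        Real.exp (s⁻¹ * (n * ((Γ⁻¹ *ᵥ sampleMean X) ⬝ᵥ μ.ofLp) - sampleSumSq Γ X / 2))) := by
  obtain ⟨k, hk, hkP⟩ := exists_multivariateGaussian_eq_withDensity (hΓ.smul hs)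
  set g : EuclideanSpace ℝ (Fin M) → ℝ := fun x => k *
    Real.exp (-(1 / 2) * ((x.ofLp - μ.ofLp) ⬝ᵥ ((s • Γ)⁻¹ *ᵥ (x.ofLp - μ.ofLp)))) with hg
  have hg0 : ∀ x, 0 ≤ g x := fun x => by positivity
  have hgi : Integrable g volume := by
    refine ⟨Continuous.aestronglyMeasurable (by fun_prop), ?_⟩
    rw [hasFiniteIntegral_iff_ofReal (ae_of_all _ hg0)]
    have : (multivariateGaussian μ (s • Γ)) Set.univ = 1 := measure_univ
    rw [hkP, withDensity_apply _ MeasurableSet.univ, Measure.restrict_univ] at this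
    rw [this]
    exact ENNReal.one_lt_top
  refine ⟨k ^ n * Real.exp (-(1 / 2) * (s⁻¹ * (n * (μ.ofLp ⬝ᵥ (Γ⁻¹ *ᵥ μ.ofLp))))),
    by positivity, ?_⟩
  rw [hkP, pi_withDensity_ofReal (fun _ => volume) (fun _ => g) (fun _ => hg0) fun _ => hgi]
  congr 1
  ext X
  congr 1
  simp only [hg]
  rw [Finset.prod_mul_distrib, ← Real.exp_sum, ← Finset.mul_sum,
    sum_dotProduct_inv_mulVec_sub hn hΓ hs, mul_assoc, ← Real.exp_add]
  simp only [Finset.prod_const, Finset.card_univ, Fintype.card_fin]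
  congr 2
  ring

theorem isAdmissibleTest_lrsdSampleTest {M n : ℕ} (hn : n ≠ 0) {v c : ℝ}
    (hΓ : (intraclass M v c).PosDef) (C : ℕ → ℝ) (i : Fin M)
    {Ω : Set (EuclideanSpace ℝ (Fin M))} (hΩ : Ω = {μ | ∀ j, 0 ≤ μ j} ∨ Ω = Set.univ) :
    IsAdmissibleTest
      (fun θ : EuclideanSpace ℝ (Fin M) × ℝ => Measure.pi fun _ : Fin n =>
        multivariateGaussian θ.1 (θ.2 • intraclass M v c))
      {θ | θ.1 ∈ Ω ∧ 0 < θ.2 ∧ θ.1 i = 0} {θ | θ.1 ∈ Ω ∧ 0 < θ.2 ∧ 0 < θ.1 i}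
      (lrsdSampleTest (intraclass M v c) C i) := by
  set Γ := intraclass M v c with hΓdef
  have hn0 : (0 : ℝ) < n := by exact_mod_cast Nat.pos_of_ne_zero hn
  set W : (Fin n → EuclideanSpace ℝ (Fin M)) → Fin M → ℝ := fun X => Γ⁻¹ *ᵥ sampleMean X with hW
  have hmc : Continuous (sampleMean : (Fin n → EuclideanSpace ℝ (Fin M)) → Fin M → ℝ) := by
    unfold sampleMean
    fun_prop
  have hTc : Continuous (sampleSumSq Γ : (Fin n → EuclideanSpace ℝ (Fin M)) → ℝ) := by
    unfold sampleSumSq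
    fun_prop
  have hWc : Continuous W := by fun_prop
  set U : (Fin n → EuclideanSpace ℝ (Fin M)) → ℝ := fun X => W X i with hU
  set V₀ : (Fin n → EuclideanSpace ℝ (Fin M)) → Fin M → ℝ :=
    fun X => W X - U X • Pi.single i 1 with hV₀
  -- The index `none` carries `-T / 2`, with `T` the sum of squares, whose natural parameter is `1 /
  -- σ²`.
  set V : (Fin n → EuclideanSpace ℝ (Fin M)) → Option (Fin M) → ℝ :=
    fun X o => o.elim (-sampleSumSq Γ X / 2) (V₀ X) with hV
  have hUc : Continuous U := by fun_prop
  have hV₀c : Continuous V₀ := by fun_prop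
  have hVc : Continuous V := by
    refine continuous_pi fun o => ?_
    cases o with
    | none => simp only [hV, Option.elim]; fun_prop
    | some j => simp only [hV, Option.elim]; fun_prop
  have hVi : ∀ X, V₀ X i = 0 := fun X => by simp [hV₀, hU]
  have hVU : ∀ X, V₀ X + U X • Pi.single i 1 = W X := fun X => by simp [hV₀]
  have hdot : ∀ (β : Option (Fin M) → ℝ) X, β ⬝ᵥ V X =
      β none * (-sampleSumSq Γ X / 2) + (fun j => β (some j)) ⬝ᵥ V₀ X := by
    intro β X
    simp [dotProduct, Fintype.sum_option, hV]
  have hΩpos : ∀ μ : EuclideanSpace ℝ (Fin M), (∀ j, 0 ≤ μ j) → μ ∈ Ω := by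
    rintro μ hμ
    rcases hΩ with rfl | rfl
    · exact hμ
    · trivial
  have hΩupd : ∀ μ ∈ Ω, WithLp.toLp 2 (Function.update μ.ofLp i 0) ∈ Ω := by
    rintro μ hμ
    rcases hΩ with rfl | rfl
    · intro j
      by_cases hj : j = i
      · simp [hj]
      · simpa [Function.update_of_ne hj] using hμ j
    · trivial
  set a : EuclideanSpace ℝ (Fin M) × ℝ → ℝ := fun θ => n * θ.2⁻¹ * θ.1 i with ha
  set b : EuclideanSpace ℝ (Fin M) × ℝ → Option (Fin M) → ℝ :=
    fun θ o => o.elim θ.2⁻¹ fun j => n * θ.2⁻¹ * θ.1 j with hb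
  have hbdot : ∀ θ X, b θ ⬝ᵥ V X = θ.2⁻¹ * (-sampleSumSq Γ X / 2) +
      n * θ.2⁻¹ * (θ.1.ofLp ⬝ᵥ V₀ X) := by
    intro θ X
    rw [hdot]
    simp [hb, dotProduct, Finset.mul_sum, mul_assoc]
  -- Inverting the natural parametrization gives `σ² = 1 / β none` and `μ j = β (some j) / (n * β
  -- none)`, with `s` in place of `β (some i)`. Positivity of `β` makes this a valid parameter with
  -- nonnegative means.
  have hparam : ∀ s : ℝ, 0 ≤ s → ∀ β : Option (Fin M) → ℝ, (∀ j, 0 < β j) →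
      ∃ θ : EuclideanSpace ℝ (Fin M) × ℝ, θ.1 ∈ Ω ∧ 0 < θ.2 ∧ θ.1 i = s * (n * β none)⁻¹ ∧
        a θ = s ∧ ∀ X, b θ ⬝ᵥ V X = β ⬝ᵥ V X := by
    intro s hs β hβ
    have hβ0 := hβ none
    refine ⟨(WithLp.toLp 2 ((n * β none)⁻¹ • Function.update (fun j => β (some j)) i s),
      (β none)⁻¹), hΩpos _ fun j => ?_, inv_pos.2 hβ0, ?_, ?_, fun X => ?_⟩
    · refine mul_nonneg (by positivity) ?_
      by_cases hj : j = i
      · simpa [hj] using hs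
      · simpa [Function.update_of_ne hj] using (hβ (some j)).le
    · simp [mul_comm]
    · simp only [ha, Pi.smul_apply, Function.update_self, smul_eq_mul, inv_inv]
      field_simp
    · rw [hbdot, hdot]
      simp only [smul_dotProduct, update_dotProduct_of_eq_zero (hVi X), inv_inv, smul_eq_mul]
      field_simp
  have hlrsd : ∀ X, lrsdSample Γ C X = lrsdSufficient n Γ C (W X, sampleSumSq Γ X) :=
    lrsdSample_eq hn hΓ C
  refine isAdmissibleTest_of_monotone_section (ν := Measure.pi fun _ => volume)
    hUc.measurable hVc.measurable (a := a) (b := b)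
    (f := fun u v => i ∈ lrsdSufficient n Γ C
      ((fun j => v (some j)) + u • Pi.single i 1, -2 * v none))
    (fun θ hθ => ⟨inferInstance, ?_⟩)
    (fun θ hθ => ?_) (fun θ hθ => ?_) (fun β hβ => ?_) (fun s hs β hβ => ?_) (fun θ hθ => ?_)
    (fun r => ?_) (fun v r s hrs h => ?_) ?_ (fun X hX => ?_) (fun X hX => ?_)
  · obtain ⟨k, hk, h⟩ := exists_pi_multivariateGaussian_eq_withDensity hn hΓ
      (show 0 < θ.2 from hθ.elim (fun h => h.2.1) fun h => h.2.1) θ.1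
    refine ⟨k, hk, h.trans ?_⟩
    congr 1
    ext X
    congr 3
    rw [hbdot]
    have h1 : (Γ⁻¹ *ᵥ sampleMean X) ⬝ᵥ θ.1.ofLp = θ.1 i * U X + θ.1.ofLp ⬝ᵥ V₀ X := by
      change W X ⬝ᵥ θ.1.ofLp = _
      rw [← hVU X, add_dotProduct, smul_dotProduct, single_one_dotProduct,
        dotProduct_comm (V₀ X), smul_eq_mul]
      ring
    rw [h1]
    simp only [ha]
    ring
  · simp [ha, hθ.2.2]
  · have h1 := hθ.2.1
    have h2 := hθ.2.2
    simp only [ha]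
    positivity
  · obtain ⟨θ, h1, h2, h3, -, h5⟩ := hparam 0 le_rfl β hβ
    exact ⟨θ, ⟨h1, h2, by rw [h3, zero_mul]⟩, h5⟩
  · obtain ⟨θ, h1, h2, h3, h4, h5⟩ := hparam s hs.le β hβ
    have := hβ none
    exact ⟨θ, ⟨h1, h2, by rw [h3]; positivity⟩, h4, h5⟩
  · refine ⟨(WithLp.toLp 2 (Function.update θ.1.ofLp i 0), θ.2), ⟨hΩupd _ hθ.1, hθ.2.1, by simp⟩,
      fun X => ?_⟩
    rw [hbdot, hbdot, update_dotProduct_of_eq_zero (hVi X)]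
  · have : Continuous fun v : Option (Fin M) → ℝ =>
        (((fun j => v (some j)) + r • Pi.single i 1, -2 * v none) : (Fin M → ℝ) × ℝ) := by
      fun_prop
    exact this.measurable (measurableSet_mem_lrsdSufficient n Γ C i)
  · have : (fun j => v (some j)) + s • Pi.single i (1 : ℝ) =
        ((fun j => v (some j)) + r • Pi.single i 1) + (s - r) • Pi.single i 1 := by
      rw [sub_smul]; abel
    rw [this]
    exact mem_lrsdSufficient_add_single hΓ (sub_nonneg.2 hrs) h
  · have hset : MeasurableSet {X : Fin n → EuclideanSpace ℝ (Fin M) | i ∈ lrsdSample Γ C X} := by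
      simp_rw [hlrsd]
      exact (hWc.prodMk hTc).measurable (measurableSet_mem_lrsdSufficient n Γ C i)
    exact Measurable.ite hset measurable_const measurable_const
  all_goals
    have h1 : (fun j => V X (some j)) = V₀ X := rfl
    have h2 : -2 * V X none = sampleSumSq Γ X := by simp only [hV, Option.elim]; ring
    rw [h1, h2, hVU, ← hlrsd] at hX
  · exact if_pos hX
  · exact if_neg hX

theorem theorem4p2 (M : ℕ) (v c : ℝ) (hΓ : (intraclass M v c).PosDef)
    (C : ℕ → ℝ) (hC : StrictAntiOn C (Set.Icc 1 M)) (i : Fin M) :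
    -- `σ²` known: each individual test is admissible, whether the means are known to be
    -- nonnegative or unrestricted
    (∀ Ω : Set (EuclideanSpace ℝ (Fin M)), (Ω = {μ | ∀ j, 0 ≤ μ j} ∨ Ω = Set.univ) →
      IsAdmissibleTest (fun μ => multivariateGaussian μ (intraclass M v c))
        {μ | μ ∈ Ω ∧ μ i = 0} {μ | μ ∈ Ω ∧ 0 < μ i}
        (lrsdTest (intraclass M v c) C i)) ∧
    -- rejection of `H_i` persists in the direction of the `i`-th column of the covariance matrix
    (∀ (x : Fin M → ℝ) (γ : ℝ), 0 < γ → i ∈ lrsd (intraclass M v c) C x →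
      i ∈ lrsd (intraclass M v c) C (x + γ • fun j => intraclass M v c j i)) ∧
    -- `σ²` unknown, sample of size `n ≥ 2`
    (∀ n : ℕ, 2 ≤ n →
      ∀ Ω : Set (EuclideanSpace ℝ (Fin M)), (Ω = {μ | ∀ j, 0 ≤ μ j} ∨ Ω = Set.univ) →
        IsAdmissibleTest
          (fun θ : EuclideanSpace ℝ (Fin M) × ℝ => Measure.pi fun _ : Fin n =>
            multivariateGaussian θ.1 (θ.2 • intraclass M v c))
          {θ | θ.1 ∈ Ω ∧ 0 < θ.2 ∧ θ.1 i = 0} {θ | θ.1 ∈ Ω ∧ 0 < θ.2 ∧ 0 < θ.1 i}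
          (lrsdSampleTest (intraclass M v c) C i)) := by
  exact ⟨fun Ω hΩ => isAdmissibleTest_lrsdTest hΓ C i hΩ,
    fun x γ hγ h => mem_lrsd_add_col hΓ hγ.le h,
    fun n hn Ω hΩ => isAdmissibleTest_lrsdSampleTest (by omega) hΓ C i hΩ⟩
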